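/- Let $1<p\le 2$ and $\frac1p+\frac1q=1$. For an at most countable set $\mathcal A$ let $\ell^2(\mathcal A)$ be the real Hilbert space of square summable families indexed by $\mathcal A$, with norm $|\cdot|$. Write $L^r$ and $L^r(\ell^2(\mathcal A))$ for the spaces of real-valued and $\ell^2(\mathcal A)$-valued functions on $[0,1]$ with Lebesgue measure. **The class $\mathcal G$.** Let $h_0=\mathbf 1_{[0,1]}$ and, for each dyadic subinterval $J$ of $[0,1]$ ($J=[0,1]$ included) with left half $J^+$ and right half $J^-$, let $h_J=|J|^{-1/2}(\mathbf 1_{J^+}-\mathbf 1_{J^-})$. For $\alpha\in\mathcal A$ let $h_0^\alpha,h_J^\alpha$ be the $\ell^2(\mathcal A)$-valued functions whose component with index $\alpha$ is $h_0$, respectively $h_J$, and whose other components vanish. A linear operator $T$ from the space of finite linear combinations of the functions $h_0^\alpha,h_J^\alpha$ to the scalar measurable functions on $[0,1]$ (modulo null sets) belongs to $\mathcal G([0,1],\ell^2(\mathcal A))$ if * for every $g\in L^2$ the pairings $(g,Th)=\int_0^1 g\,Th$ exist and $\|g\|_{L^2}^2=\sum_{\alpha}(g,Th_0^\alpha)^2+\sum_{\alpha,J}(g,Th_J^\alpha)^2$;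 * $Th_J^\alpha=0$ a.e. outside $J$, for all $\alpha$ and $J$. **The class $\mathcal K^p$.** Let $\Omega_p=\{x=(x_1,x_2,x_3,x_4)\in\ell^2(\mathcal A)\times[0,\infty)^3:\ |x_1|^p\le x_3,\ x_2\le x_4^{2/q}\}$. A continuous function $B:\Omega_p\to\mathbb R$ belongs to $\mathcal K^p(\ell^2(\mathcal A))$ if $B(x)\ge 0$ whenever $|x_1|^p=x_3$, and if $$B(x)\ \ge\ \frac{|x_1^+-x_1^-|}{2}\,|\Delta|+\frac{B(x^+)+B(x^-)}{2}$$ whenever $x,x^\pm\in\Omega_p$ and $\Delta\in\mathbb R$ satisfy $\frac{x^++x^-}{2}-x=(0,\Delta^2,0,0)$. **Admissible constants.** For $t\ge0$, $\delta>0$ and $y\in[0,\infty)^4$ put $$\mathcal B_0(y)=2(y_3+y_4)-y_1^p-y_2^{q/2}-\delta\begin{cases} y_1^{2-p}y_2+y_1^{2-p-2t(p-1)}y_2^{t+1}, & y_1^p\ge y_2^{q/2},\\[2pt] \frac2q(2+t)\,y_2^{q/2}+\frac2p\,(2-p-t(p-1))\,y_1^p, & y_1^p\le y_2^{q/2},\end{cases}$$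 where the first line is read as $0$ at $y_1=y_2=0$. Call a triple $(t,\delta,C)$ with $t\ge0$, $\delta>0$, $C>0$ admissible for $\mathcal A$ if the restriction of $x\mapsto C\,\mathcal B_0(|x_1|,x_2,x_3,x_4)$ to $\Omega_p$ belongs to $\mathcal K^p(\ell^2(\mathcal A))$. **Statement.** 1. There is a triple $(t_p,\delta_p,C_p)$, depending only on $p$, that is admissible for every at most countable $\mathcal A$. 2. Let $\mathcal A$ be at most countable and $T\in\mathcal G([0,1],\ell^2(\mathcal A))$. Then $T$ has a unique extension to a bounded linear operator $L^2(\ell^2(\mathcal A))\to L^2$, again denoted by $T$. For every triple $(t,\delta,C_p)$ that is admissible for $\mathcal A$ (in particular for the one in part 1) and every $f\in L^2(\ell^2(\mathcal A))$, $$\|Tf\|_{L^p}\le\bigl(2p^{1/p}q^{1/q}C_p+1\bigr)\,\|f\|_{L^p}.$$ -/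

import Mathlib

open MeasureTheory Set
open scoped ENNReal

universe u

/-- The Hilbert space `ℓ²(𝒜)` of real square summable families indexed by `𝒜`. -/
abbrev EllTwo (𝒜 : Type*) : Type _ := lp (fun _ : 𝒜 => ℝ) 2

/-- Lebesgue measure on the interval `[0,1]`. -/
noncomputable abbrev unitMeasure : Measure ℝ := volume.restrict (Icc (0 : ℝ) 1)

/-- The dyadic interval `[k 2⁻ⁿ, (k+1) 2⁻ⁿ)`, of length `2⁻ⁿ`. -/
def dyadicInterval (n k : ℕ) : Set ℝ :=
  Ico ((k : ℝ) / 2 ^ n) (((k : ℝ) + 1) / 2 ^ n)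

/-- Labels of the dyadic subintervals of `[0,1]`: the pair `⟨n, k⟩` with `k < 2ⁿ` labels
`dyadicInterval n k` (end points are immaterial, all functions being taken up to null sets). -/
abbrev DyadicLabel : Type := Σ n : ℕ, Fin (2 ^ n)

/-- The dyadic subinterval of `[0,1]` with a given label. -/
def DyadicLabel.toSet (J : DyadicLabel) : Set ℝ := dyadicInterval J.1 J.2

/-- The scalar Haar functions on `[0,1]`. The label `none` stands for `h₀ = 1`, and `some J` for
`h_J = |J|^(-1/2) (1_{J⁺} - 1_{J⁻})`, where `J⁺` and `J⁻` are the left and the right half of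
`J = [k 2⁻ⁿ, (k+1) 2⁻ⁿ)`, and `|J|^(-1/2) = √(2ⁿ)`. -/
noncomputable def haarFun : Option DyadicLabel → ℝ → ℝ
  | none => fun _ => 1
  | some J => fun x =>
      √(2 ^ J.1) * ((dyadicInterval (J.1 + 1) (2 * J.2)).indicator (fun _ => (1 : ℝ)) x
        - (dyadicInterval (J.1 + 1) (2 * J.2 + 1)).indicator (fun _ => (1 : ℝ)) x)

open Classical in
/-- The vector Haar function `h^α`, as a function: its component with index `α` is the scalar
Haar function, and its other components vanish. -/
noncomputable def vectorHaarFun {𝒜 : Type*} (i : Option DyadicLabel) (α : 𝒜) (x : ℝ) :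
    EllTwo 𝒜 :=
  haarFun i x • lp.single 2 α (1 : ℝ)

theorem measurable_haarFun (i : Option DyadicLabel) : Measurable (haarFun i) := by
  cases i with
  | none => exact measurable_const
  | some J =>
    refine Measurable.const_mul (Measurable.sub ?_ ?_) _ <;>
    exact measurable_const.indicator measurableSet_Ico

theorem exists_bound_haarFun (i : Option DyadicLabel) : ∃ C : ℝ, ∀ x, ‖haarFun i x‖ ≤ C := by
  cases i with
  | none => exact ⟨1, fun x => by simp [haarFun]⟩
  | some J =>
    refine ⟨√(2 ^ J.1) * (1 + 1), fun x => ?_⟩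
    simp only [haarFun, norm_mul]
    rw [Real.norm_of_nonneg (Real.sqrt_nonneg _)]
    refine mul_le_mul_of_nonneg_left ((norm_sub_le _ _).trans (add_le_add ?_ ?_))
      (Real.sqrt_nonneg _) <;>
    · refine (norm_indicator_le_norm_self _ _).trans ?_
      simp

theorem memLp_vectorHaarFun {𝒜 : Type*} (i : Option DyadicLabel) (α : 𝒜) :
    MemLp (vectorHaarFun i α) 2 unitMeasure := by
  classical
  obtain ⟨C, hC⟩ := exists_bound_haarFun i
  refine MemLp.of_bound
    ((measurable_haarFun i).stronglyMeasurable.smul_const _).aestronglyMeasurable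
    (C * ‖(lp.single 2 α (1 : ℝ) : EllTwo 𝒜)‖) (Filter.Eventually.of_forall fun x => ?_)
  unfold vectorHaarFun
  rw [norm_smul]
  convert mul_le_mul_of_nonneg_right (hC x) (norm_nonneg _)

/-- The vector Haar function `h^α` as an element of `L²([0,1], ℓ²(𝒜))`. -/
noncomputable def vectorHaar {𝒜 : Type*} (i : Option DyadicLabel) (α : 𝒜) :
    Lp (EllTwo 𝒜) 2 unitMeasure :=
  (memLp_vectorHaarFun i α).toLp (vectorHaarFun i α)

/-- The space of finite linear combinations of the vector Haar functions. -/
noncomputable def haarSpan (𝒜 : Type*) : Submodule ℝ (Lp (EllTwo 𝒜) 2 unitMeasure) :=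
  Submodule.span ℝ (range fun j : Option DyadicLabel × 𝒜 => vectorHaar j.1 j.2)

/-- The vector Haar function `h^α` as an element of the space of finite linear combinations. -/
noncomputable def haarElt {𝒜 : Type*} (i : Option DyadicLabel) (α : 𝒜) : haarSpan 𝒜 :=
  ⟨vectorHaar i α, Submodule.subset_span ⟨(i, α), rfl⟩⟩

/-- The class `𝒢([0,1], ℓ²(𝒜))` of linear operators that send finite linear combinations of the
vector Haar functions to scalar measurable functions on `[0,1]` (modulo null sets). -/
structure IsClassG {𝒜 : Type*} (T : haarSpan 𝒜 →ₗ[ℝ] (ℝ →ₘ[unitMeasure] ℝ)) : Prop where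
  /-- The pairings `(g, T h)` with `g ∈ L²` make sense. -/
  integrable : ∀ (g : Lp ℝ 2 unitMeasure) (i : Option DyadicLabel) (α : 𝒜),
    Integrable (fun x => g x * T (haarElt i α) x) unitMeasure
  /-- Parseval's identity for the images of all the vector Haar functions. -/
  parseval : ∀ g : Lp ℝ 2 unitMeasure,
    HasSum (fun j : Option DyadicLabel × 𝒜 =>
      (∫ x, g x * T (haarElt j.1 j.2) x ∂unitMeasure) ^ 2) (‖g‖ ^ 2)
  /-- `supp T h_J^α ⊆ J`. -/
  support : ∀ (J : DyadicLabel) (α : 𝒜),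
    ∀ᵐ x ∂unitMeasure, x ∉ J.toSet → T (haarElt (some J) α) x = 0

/-- `S` is a bounded operator `L²([0,1], ℓ²(𝒜)) → L²([0,1])` that extends `T`. -/
def IsBoundedExtension {𝒜 : Type*} (T : haarSpan 𝒜 →ₗ[ℝ] (ℝ →ₘ[unitMeasure] ℝ))
    (S : Lp (EllTwo 𝒜) 2 unitMeasure →L[ℝ] Lp ℝ 2 unitMeasure) : Prop :=
  ∀ f : haarSpan 𝒜, ((S (f : Lp (EllTwo 𝒜) 2 unitMeasure) : Lp ℝ 2 unitMeasure) :
    ℝ →ₘ[unitMeasure] ℝ) = T f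

/-- The domain `Ω_p ⊆ ℓ²(𝒜) × [0,∞)³`, with `q` the exponent conjugate to `p`. -/
def bellmanDomain (p q : ℝ) (𝒜 : Type*) : Set (EllTwo 𝒜 × ℝ × ℝ × ℝ) :=
  {x | 0 ≤ x.2.1 ∧ 0 ≤ x.2.2.1 ∧ 0 ≤ x.2.2.2 ∧
    ‖x.1‖ ^ p ≤ x.2.2.1 ∧ x.2.1 ≤ x.2.2.2 ^ (2 / q)}

/-- The restriction of `B` to `Ω_p` belongs to the class `𝒦^p(ℓ²(𝒜))`. -/
structure IsClassK (p q : ℝ) {𝒜 : Type*} (B : EllTwo 𝒜 × ℝ × ℝ × ℝ → ℝ) : Prop where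
  continuousOn : ContinuousOn B (bellmanDomain p q 𝒜)
  boundary : ∀ x ∈ bellmanDomain p q 𝒜, ‖x.1‖ ^ p = x.2.2.1 → 0 ≤ B x
  concave : ∀ x ∈ bellmanDomain p q 𝒜, ∀ xp ∈ bellmanDomain p q 𝒜,
    ∀ xm ∈ bellmanDomain p q 𝒜, ∀ Δ : ℝ,
      (1 / 2 : ℝ) • (xp + xm) - x = (0, Δ ^ 2, 0, 0) →
        ‖xp.1 - xm.1‖ / 2 * |Δ| + (B xp + B xm) / 2 ≤ B x

open Classical in
/-- The function `ℬ₀` of four nonnegative variables, with parameters `t` and `δ`. -/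
noncomputable def bellmanZero (p q t δ y₁ y₂ y₃ y₄ : ℝ) : ℝ :=
  2 * (y₃ + y₄) - y₁ ^ p - y₂ ^ (q / 2) -
    δ * (if y₂ ^ (q / 2) ≤ y₁ ^ p then
        y₁ ^ (2 - p) * y₂ + y₁ ^ (2 - p - 2 * t * (p - 1)) * y₂ ^ (t + 1)
      else
        2 / q * (2 + t) * y₂ ^ (q / 2) + 2 / p * (2 - p - t * (p - 1)) * y₁ ^ p)

/-- The Bellman candidate `ℬ(x) = C ℬ₀(|x₁|, x₂, x₃, x₄)`. -/
noncomputable def bellmanCandidate (p q t δ C : ℝ) {𝒜 : Type*}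
    (x : EllTwo 𝒜 × ℝ × ℝ × ℝ) : ℝ :=
  C * bellmanZero p q t δ ‖x.1‖ x.2.1 x.2.2.1 x.2.2.2

/-- The parameters `t ≥ 0`, `δ > 0` and the constant `C > 0` are such that the restriction to `Ω_p`
of the candidate `C ℬ₀(|x₁|, x₂, x₃, x₄)` is in `𝒦^p(ℓ²(𝒜))`. -/
structure IsAdmissible (p q t δ C : ℝ) (𝒜 : Type*) : Prop where
  t_nonneg : 0 ≤ t
  δ_pos : 0 < δ
  C_pos : 0 < C
  mem_classK : IsClassK p q (bellmanCandidate p q t δ C (𝒜 := 𝒜))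

/-! Admissible parameters. Take `t = 1`. The coordinates `x₃`, `x₄` enter linearly, so the concavity
condition is a lower bound for the midpoint convexity defect of `‖a‖^p + s^(q/2) + δ ψ(‖a‖, s)`,
where `ψ` is `bellmanPsi`. In the open quadrant `ψ` is `C¹` across the curve `s = y^(2p-2)`, and `K
y^p + ψ` is jointly convex for a suitable `K` (`convexOn_add_bellmanPsi`). With `δ = 1/(2K)`, half
of `‖a‖^p` absorbs the nonconvexity of `δ ψ`. The other half has a convexity defect of order `(‖a‖ +
‖d‖)^(p-2) ‖d‖²` (`rpow_norm_uniform_convex`), and raising `s` by `Δ²` gains `|Δ|^q` from `s^(q/2)`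
and `‖a‖^(2-p) Δ²` from `ψ`. These gains dominate a multiple of `‖d‖ |Δ|`, by AM-GM if `‖d‖ ≤ ‖a‖`
and by Young otherwise (`min_mul_le_of_growth`). Only the inner product structure of `ℓ²(𝒜)` is
used, so the constants depend on `p` alone.

The operator. Parseval and Cauchy-Schwarz give `(g, Tf) ≤ ‖f‖₂ ‖g‖₂` on the Haar span. Hence `T`
maps this dense span contractively into `L²` and extends uniquely.

For the `L^p` bound, let `β_J` be the vector of pairings `(g, T h_J^α)`, and attach to each dyadic
interval `I` the means over `I` of `f`, `‖f‖^p`, `|g|^q` and, as second coordinate, the mean of `g²`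
minus `|I|⁻¹ ∑_{J ⊆ I} ‖β_J‖²`. By the support condition these pairings see only `g` on `I`, so the
second coordinate is nonnegative and the point lies in `Ω_p`. Passing to the halves of `I` raises
the mean of the second coordinate by `‖β_I‖² / |I|`, and concavity bounds `‖f_I‖ ‖β_I‖` by a
telescoping difference of values of the Bellman function (`bellmanPoint_step`). On intervals where
`f` is constant the boundary condition stops the induction, and the sum is at most `2C(‖f‖_p^p +
‖g‖_q^q)` by `bellmanCandidate_le`. The `h₀` term costs a further `‖f‖_p ‖g‖_q`. Optimal scaling of
`f` and `g`, duality and `L²` density finish the proof. -/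

/-! ### Gluing `C²` pieces of one variable -/

-- The sets `φ ≤ 0` and `0 ≤ φ` cover the line, so the derivatives within each of them combine. A
-- set whose closure misses `x` imposes no condition.
open Filter Topology in
theorem hasDerivAt_of_glued {h G₁ G₂ φ : ℝ → ℝ} {x c : ℝ} (hφ : ContinuousAt φ x)
    (h₁ : ∀ᶠ z in 𝓝 x, φ z ≤ 0 → h z = G₁ z) (h₂ : ∀ᶠ z in 𝓝 x, 0 ≤ φ z → h z = G₂ z)
    (d₁ : φ x ≤ 0 → HasDerivAt G₁ c x) (d₂ : 0 ≤ φ x → HasDerivAt G₂ c x) :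
    HasDerivAt h c x := by
  have e₁ : HasDerivWithinAt h c {z | φ z ≤ 0} x := by
    by_cases hx : φ x ≤ 0
    · exact (d₁ hx).hasDerivWithinAt.congr_of_eventuallyEq
        (eventually_nhdsWithin_iff.2 h₁) (h₁.self_of_nhds hx)
    · refine hasDerivWithinAt_iff_hasFDerivWithinAt.2
        (HasFDerivWithinAt.of_notMem_closure fun hc => ?_)
      obtain ⟨z, hz, hz'⟩ := (mem_closure_iff_frequently.1 hc).and_eventually
        (hφ.eventually (lt_mem_nhds (not_le.1 hx))) |>.exists
      exact absurd hz (not_le.2 hz')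
  have e₂ : HasDerivWithinAt h c {z | 0 ≤ φ z} x := by
    by_cases hx : 0 ≤ φ x
    · exact (d₂ hx).hasDerivWithinAt.congr_of_eventuallyEq
        (eventually_nhdsWithin_iff.2 h₂) (h₂.self_of_nhds hx)
    · refine hasDerivWithinAt_iff_hasFDerivWithinAt.2
        (HasFDerivWithinAt.of_notMem_closure fun hc => ?_)
      obtain ⟨z, hz, hz'⟩ := (mem_closure_iff_frequently.1 hc).and_eventually
        (hφ.eventually (gt_mem_nhds (not_le.1 hx))) |>.exists
      exact absurd hz (not_le.2 hz')
  have := e₁.union e₂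
  rwa [show {z | φ z ≤ 0} ∪ {z | 0 ≤ φ z} = univ from
    eq_univ_of_forall fun z => le_total (φ z) 0, hasDerivWithinAt_univ] at this

open Filter Topology in
theorem continuousAt_of_glued {h G₁ G₂ φ : ℝ → ℝ} {x : ℝ} (hφ : ContinuousAt φ x)
    (h₁ : ∀ᶠ z in 𝓝 x, φ z ≤ 0 → h z = G₁ z) (h₂ : ∀ᶠ z in 𝓝 x, 0 ≤ φ z → h z = G₂ z)
    (d₁ : φ x ≤ 0 → ContinuousAt G₁ x) (d₂ : 0 ≤ φ x → ContinuousAt G₂ x) :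
    ContinuousAt h x := by
  have e₁ : ContinuousWithinAt h {z | φ z ≤ 0} x := by
    by_cases hx : φ x ≤ 0
    · exact (d₁ hx).continuousWithinAt.congr_of_eventuallyEq
        (eventually_nhdsWithin_iff.2 h₁) (h₁.self_of_nhds hx)
    · refine continuousWithinAt_of_notMem_closure fun hc => ?_
      obtain ⟨z, hz, hz'⟩ := (mem_closure_iff_frequently.1 hc).and_eventually
        (hφ.eventually (lt_mem_nhds (not_le.1 hx))) |>.exists
      exact absurd hz (not_le.2 hz')
  have e₂ : ContinuousWithinAt h {z | 0 ≤ φ z} x := by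
    by_cases hx : 0 ≤ φ x
    · exact (d₂ hx).continuousWithinAt.congr_of_eventuallyEq
        (eventually_nhdsWithin_iff.2 h₂) (h₂.self_of_nhds hx)
    · refine continuousWithinAt_of_notMem_closure fun hc => ?_
      obtain ⟨z, hz, hz'⟩ := (mem_closure_iff_frequently.1 hc).and_eventually
        (hφ.eventually (gt_mem_nhds (not_le.1 hx))) |>.exists
      exact absurd hz (not_le.2 hz')
  have := e₁.union e₂
  rwa [show {z | φ z ≤ 0} ∪ {z | 0 ≤ φ z} = univ from
    eq_univ_of_forall fun z => le_total (φ z) 0, continuousWithinAt_univ] at this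

-- At the interface the left and right branches may have different derivatives `c₁`, `c₂`. A lower
-- bound on right slopes survives because each nearby point lies on one of the two branches.
open Filter Topology in
theorem eventually_slope_of_glued {h G₁ G₂ φ : ℝ → ℝ} {x c₁ c₂ r : ℝ} (hφ : ContinuousAt φ x)
    (h₁ : ∀ᶠ z in 𝓝 x, φ z ≤ 0 → h z = G₁ z) (h₂ : ∀ᶠ z in 𝓝 x, 0 ≤ φ z → h z = G₂ z)
    (d₁ : HasDerivAt G₁ c₁ x) (d₂ : HasDerivAt G₂ c₂ x)
    (p₁ : φ x ≤ 0 → r < c₁) (p₂ : 0 ≤ φ x → r < c₂) :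
    ∀ᶠ z in 𝓝[>] x, r < slope h x z := by
  have hle : 𝓝[>] x ≤ 𝓝[≠] x := nhdsWithin_mono _ fun z hz => ne_of_gt hz
  have e₁ : ∀ᶠ z in 𝓝[>] x, φ z ≤ 0 → r < slope h x z := by
    by_cases hx : φ x ≤ 0
    · filter_upwards [hle (d₁.tendsto_slope.eventually (lt_mem_nhds (p₁ hx))),
        nhdsWithin_le_nhds h₁] with z hz hz1 hz'
      rwa [slope_def_field, hz1 hz', h₁.self_of_nhds hx, ← slope_def_field]
    · filter_upwards [nhdsWithin_le_nhds (hφ.eventually (lt_mem_nhds (not_le.1 hx)))] with z hz hz'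
      exact absurd hz' (not_le.2 hz)
  have e₂ : ∀ᶠ z in 𝓝[>] x, 0 ≤ φ z → r < slope h x z := by
    by_cases hx : 0 ≤ φ x
    · filter_upwards [hle (d₂.tendsto_slope.eventually (lt_mem_nhds (p₂ hx))),
        nhdsWithin_le_nhds h₂] with z hz hz2 hz'
      rwa [slope_def_field, hz2 hz', h₂.self_of_nhds hx, ← slope_def_field]
    · filter_upwards [nhdsWithin_le_nhds (hφ.eventually (gt_mem_nhds (not_le.1 hx)))] with z hz hz'
      exact absurd hz' (not_le.2 hz)
  filter_upwards [e₁, e₂] with z h1 h2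
  exact (le_total (φ z) 0).elim h1 h2

open Filter Topology in
/-- A function on `[0,1]` glued from two `C²` pieces, with matching values and derivatives,
is convex as soon as each piece has nonnegative second derivative where it is used. -/
theorem convexOn_of_glued {g F₁ F₂ F₁' F₂' F₁'' F₂'' φ : ℝ → ℝ}
    (hg : ContinuousOn g (Icc 0 1)) (hφ : ContinuousOn φ (Ioo 0 1))
    (h₁ : ∀ x ∈ Ioo (0 : ℝ) 1, φ x ≤ 0 → g x = F₁ x) (h₂ : ∀ x ∈ Ioo (0 : ℝ) 1, 0 ≤ φ x → g x = F₂ x)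
    (d₁ : ∀ x ∈ Ioo (0 : ℝ) 1, HasDerivAt F₁ (F₁' x) x)
    (d₂ : ∀ x ∈ Ioo (0 : ℝ) 1, HasDerivAt F₂ (F₂' x) x)
    (dd₁ : ∀ x ∈ Ioo (0 : ℝ) 1, HasDerivAt F₁' (F₁'' x) x)
    (dd₂ : ∀ x ∈ Ioo (0 : ℝ) 1, HasDerivAt F₂' (F₂'' x) x)
    (n₁ : ∀ x ∈ Ioo (0 : ℝ) 1, φ x ≤ 0 → 0 ≤ F₁'' x)
    (n₂ : ∀ x ∈ Ioo (0 : ℝ) 1, 0 ≤ φ x → 0 ≤ F₂'' x)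
    (he : ∀ x ∈ Ioo (0 : ℝ) 1, φ x = 0 → F₁' x = F₂' x) :
    ConvexOn ℝ (Icc 0 1) g := by
  classical
  -- This is the derivative of `g`. It is continuous but may fail to be differentiable on the
  -- interface, so its monotonicity comes from right lower slopes rather than from a second
  -- derivative.
  set h : ℝ → ℝ := fun x => if φ x ≤ 0 then F₁' x else F₂' x with hh
  have hh₁ : ∀ x, φ x ≤ 0 → h x = F₁' x := fun x hx => by simp [hh, hx]
  have hh₂ : ∀ x ∈ Ioo (0 : ℝ) 1, 0 ≤ φ x → h x = F₂' x := fun x hx0 hx => by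
    rcases hx.eq_or_lt with hx | hx
    · simp [hh, ← hx, he x hx0 hx.symm]
    · simp [hh, hx]
  have hφa : ∀ x ∈ Ioo (0 : ℝ) 1, ContinuousAt φ x := fun x hx =>
    hφ.continuousAt (Ioo_mem_nhds hx.1 hx.2)
  have hev : ∀ x ∈ Ioo (0 : ℝ) 1, ∀ {P : ℝ → Prop}, (∀ x ∈ Ioo (0 : ℝ) 1, P x) →
      ∀ᶠ z in 𝓝 x, P z := fun x hx P hP => by
    filter_upwards [Ioo_mem_nhds hx.1 hx.2] with z hz using hP z hz
  have hd : ∀ x ∈ Ioo (0 : ℝ) 1, HasDerivAt g (h x) x := fun x hx =>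
    hasDerivAt_of_glued (hφa x hx) (hev x hx h₁) (hev x hx h₂) (fun h0 => hh₁ x h0 ▸ d₁ x hx)
      (fun h0 => hh₂ x hx h0 ▸ d₂ x hx)
  refine MonotoneOn.convexOn_of_deriv (convex_Icc 0 1) hg ?_ ?_
  · rw [interior_Icc]
    exact fun x hx => (hd x hx).differentiableAt.differentiableWithinAt
  rw [interior_Icc]
  intro a ha b hb hab
  rw [(hd a ha).deriv, (hd b hb).deriv]
  have hsub : Icc a b ⊆ Ioo 0 1 := fun x hx => ⟨ha.1.trans_le hx.1, hx.2.trans_lt hb.2⟩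
  have key := image_le_of_liminf_slope_right_le_deriv_boundary (f := fun x => - h x)
    (a := a) (b := b) (B := fun _ => - h a) (B' := fun _ => 0) ?_ le_rfl continuousOn_const
    (fun x _ => hasDerivWithinAt_const _ _ _) ?_ (right_mem_Icc.2 hab)
  · exact neg_le_neg_iff.1 key
  · exact fun x hx => (continuousAt_of_glued (hφa x (hsub hx))
      (Eventually.of_forall hh₁) (hev x (hsub hx) hh₂)
      (fun _ => (dd₁ x (hsub hx)).continuousAt)
      (fun _ => (dd₂ x (hsub hx)).continuousAt)).neg.continuousWithinAt
  · intro x hx r hr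
    have hx' := hsub ⟨hx.1, hx.2.le⟩
    refine Eventually.frequently ?_
    filter_upwards [eventually_slope_of_glued (r := -r) (hφa x hx')
      (Eventually.of_forall hh₁) (hev x hx' hh₂) (dd₁ x hx')
      (dd₂ x hx') (fun h0 => (neg_lt_zero.2 hr).trans_le (n₁ x hx' h0))
      (fun h0 => (neg_lt_zero.2 hr).trans_le (n₂ x hx' h0))] with z hz
    rw [slope_def_field] at hz ⊢
    have : (-h z - -h x) / (z - x) = - ((h z - h x) / (z - x)) := by ring
    rw [this]; linarith

/-! ### The perturbation term: joint convexity and growth -/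

/-- The perturbation term of the Bellman candidate for `t = 1`. -/
noncomputable def bellmanPsi (p q y s : ℝ) : ℝ :=
  if s ^ (q / 2) ≤ y ^ p then y ^ (2 - p) * s + y ^ (4 - 3 * p) * s ^ 2
  else 6 / q * s ^ (q / 2) + (2 - 6 / q) * y ^ p

/-- The multiple of `y ^ p` that makes `bellmanPsi` convex. -/
noncomputable def convexityConst (p : ℝ) : ℝ := 4 + 13 / (p - 1)

theorem convexityConst_ge {p : ℝ} (hp : 1 < p) : 4 ≤ convexityConst p := by
  unfold convexityConst
  have : 0 ≤ 13 / (p - 1) := div_nonneg (by norm_num) (by linarith)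
  linarith

/-- The expression is the second derivative of `K y^p + ψ` in direction `(e, f)` on the first
branch. In the scale-free variable `l = s / y^(2p-2)`, with `0 < l ≤ 1`, it is a quadratic form with
bounded coefficients; completing the square leaves `a - b²/2`, where `|b| ≤ 5` and `a ≥ 13`. This is
where the 13 in `convexityConst` comes from, while its 4 absorbs the negative terms of `a`. -/
theorem hessian_nonneg_of_le {p y s e f : ℝ} (hp : 1 < p) (hp2 : p ≤ 2) (hy : 0 < y) (hs : 0 < s)
    (hsy : s ≤ y ^ (2 * p - 2)) :
    0 ≤ convexityConst p * (p * ((p - 1) * y ^ (p - 2) * e) * e)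
      + ((2 - p) * ((1 - p) * y ^ (-p) * e) * e * s + (2 - p) * y ^ (1 - p) * e * f
          + (2 - p) * y ^ (1 - p) * e * f)
      + ((4 - 3 * p) * ((3 - 3 * p) * y ^ (2 - 3 * p) * e) * e * s ^ 2
          + (4 - 3 * p) * y ^ (3 - 3 * p) * e * (2 * s * f)
          + ((4 - 3 * p) * y ^ (3 - 3 * p) * e * (2 * s * f) + y ^ (4 - 3 * p) * (2 * f * f))) := by
  set μ := y ^ (2 * p - 2) with hμ
  set A := y ^ (p - 2) with hA
  set n := y ^ (4 - 3 * p) with hn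
  set m := y ^ (1 - p) with hm
  have μ0 : 0 < μ := Real.rpow_pos_of_pos hy _
  have n0 : 0 < n := Real.rpow_pos_of_pos hy _
  obtain ⟨l, hl⟩ : ∃ l, s = l * μ := ⟨s / μ, by field_simp⟩
  have l0 : 0 < l := by
    have := hl ▸ hs
    exact pos_of_mul_pos_left this μ0.le
  have l1 : l ≤ 1 := by
    by_contra h
    nlinarith
  have e1 : y ^ (-p) * μ = A := by rw [hμ, hA, ← Real.rpow_add hy]; ring_nf
  have e2 : y ^ (2 - 3 * p) * μ ^ 2 = A := by
    rw [hμ, hA, ← Real.rpow_natCast, ← Real.rpow_mul hy.le, ← Real.rpow_add hy]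
    push_cast; ring_nf
  have e3 : y ^ (3 - 3 * p) * μ = m := by rw [hμ, hm, ← Real.rpow_add hy]; ring_nf
  have e4 : m ^ 2 = A * n := by
    rw [hm, hA, hn, ← Real.rpow_natCast, ← Real.rpow_mul hy.le, ← Real.rpow_add hy]
    push_cast; ring_nf
  set a := convexityConst p * p * (p - 1) - (2 - p) * (p - 1) * l
    - 3 * (p - 1) * (4 - 3 * p) * l ^ 2 with ha
  set b := (2 - p) + 2 * (4 - 3 * p) * l with hb
  have hK : convexityConst p * (p - 1) = 4 * (p - 1) + 13 := by
    unfold convexityConst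
    have : p - 1 ≠ 0 := by linarith
    field_simp
  have b1 : b ≤ 5 := by rw [hb]; nlinarith
  have b2 : -5 ≤ b := by rw [hb]; nlinarith
  have hbsq : b ^ 2 ≤ 25 := by nlinarith
  have ha13 : 13 ≤ a := by
    have h1 : (2 - p) * (p - 1) * l ≤ (p - 1) := by
      have : (2 - p) * l ≤ 1 := by nlinarith
      nlinarith
    have h2 : (p - 1) * ((4 - 3 * p) * l ^ 2) ≤ (p - 1) * 1 := by
      refine mul_le_mul_of_nonneg_left ?_ (by linarith)
      nlinarith [sq_nonneg l]
    have h3 : convexityConst p * p * (p - 1) = (4 * (p - 1) + 13) * p := by rw [← hK]; ring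
    rw [ha, h3]; nlinarith
  have key : (convexityConst p * (p * ((p - 1) * A * e) * e)
      + ((2 - p) * ((1 - p) * y ^ (-p) * e) * e * s + (2 - p) * m * e * f
          + (2 - p) * m * e * f)
      + ((4 - 3 * p) * ((3 - 3 * p) * y ^ (2 - 3 * p) * e) * e * s ^ 2
          + (4 - 3 * p) * y ^ (3 - 3 * p) * e * (2 * s * f)
          + ((4 - 3 * p) * y ^ (3 - 3 * p) * e * (2 * s * f) + n * (2 * f * f))))
      = A * e ^ 2 * a + 2 * m * e * f * b + 2 * n * f ^ 2 := by
    rw [hl, ha, hb]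
    linear_combination (2 - p) * (1 - p) * e ^ 2 * l * e1
      + (4 - 3 * p) * (3 - 3 * p) * e ^ 2 * l ^ 2 * e2 + 4 * (4 - 3 * p) * e * l * f * e3
  rw [key]
  -- After multiplication by `n` the relation `m² = A n` makes the form quadratic in `n f` and `m
  -- e`.
  refine nonneg_of_mul_nonneg_right (?_ : 0 ≤ n * _) n0
  have : n * (A * e ^ 2 * a + 2 * m * e * f * b + 2 * n * f ^ 2)
      = 2 * (n * f + b / 2 * (m * e)) ^ 2 + (m * e) ^ 2 * (a - b ^ 2 / 2) := by
    linear_combination (- e ^ 2 * a) * e4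
  rw [this]
  have : 0 ≤ a - b ^ 2 / 2 := by linarith
  positivity

theorem conj_exponent {p q : ℝ} (hp : 1 < p) (hp2 : p ≤ 2) (hpq : 1 / p + 1 / q = 1) :
    2 ≤ q ∧ (2 * p - 2) * (q / 2) = p := by
  have hq : q ≠ 0 := by
    rintro rfl
    rw [div_zero, add_zero, div_eq_one_iff_eq (by linarith)] at hpq
    linarith
  have h1 : q + p = p * q := by
    have : p ≠ 0 := by linarith
    field_simp at hpq; exact hpq
  exact ⟨by nlinarith, by nlinarith⟩

/-- The interface is the curve `s = y^(2p-2)`, since `(2p-2)(q/2) = p`. -/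
theorem rpow_le_iff_le_rpow {p q y s : ℝ} (hp : 1 < p) (hp2 : p ≤ 2) (hpq : 1 / p + 1 / q = 1)
    (hy : 0 ≤ y) (hs : 0 ≤ s) : s ^ (q / 2) ≤ y ^ p ↔ s ≤ y ^ (2 * p - 2) := by
  obtain ⟨hq, he⟩ := conj_exponent hp hp2 hpq
  conv_lhs => rw [← he, Real.rpow_mul hy]
  exact Real.rpow_le_rpow_iff hs (by positivity) (by linarith)

/-- On the interface both branches equal `2 y^p`, so the second formula is valid on a closed region.
The origin is separate because `4 - 3p` can be negative. -/
theorem bellmanPsi_of_ge {p q y s : ℝ} (hp : 1 < p) (hp2 : p ≤ 2) (hpq : 1 / p + 1 / q = 1)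
    (hy : 0 ≤ y) (hs : 0 ≤ s) (h : y ^ p ≤ s ^ (q / 2)) :
    bellmanPsi p q y s = 6 / q * s ^ (q / 2) + (2 - 6 / q) * y ^ p := by
  rcases h.eq_or_lt with h | h
  · obtain ⟨hq, he⟩ := conj_exponent hp hp2 hpq
    have hs' : s = y ^ (2 * p - 2) := by
      rw [← he, Real.rpow_mul hy] at h
      exact ((Real.rpow_left_inj (by positivity) hs (by linarith)).1 h).symm
    rcases hy.eq_or_lt with rfl | hy
    · rw [Real.zero_rpow (by linarith)] at hs'
      subst hs'
      rw [bellmanPsi, if_pos h.symm.le, ← h, Real.zero_rpow (by linarith : p ≠ 0)]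
      simp
    rw [bellmanPsi, if_pos h.symm.le, ← h, hs', ← Real.rpow_natCast, ← Real.rpow_mul hy.le,
      ← Real.rpow_add hy, ← Real.rpow_add hy]
    push_cast; ring_nf
  · rw [bellmanPsi, if_neg (not_le.2 h)]

theorem bellmanPsi_nonneg {p q y s : ℝ} (hp : 1 < p) (hp2 : p ≤ 2) (hpq : 1 / p + 1 / q = 1)
    (hy : 0 ≤ y) (hs : 0 ≤ s) : 0 ≤ bellmanPsi p q y s := by
  obtain ⟨hq, he⟩ := conj_exponent hp hp2 hpq
  unfold bellmanPsi
  split_ifs with h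
  · positivity
  · have h1 : 0 ≤ y ^ p := by positivity
    have h2 : 0 ≤ 6 / q := div_nonneg (by norm_num) (by linarith)
    nlinarith

/-- Used twice: it gives continuity at the origin, and positivity of the candidate as soon as `3 δ ≤
1`. -/
theorem bellmanPsi_le {p q y s : ℝ} (hp : 1 < p) (hp2 : p ≤ 2) (hpq : 1 / p + 1 / q = 1)
    (hy : 0 ≤ y) (hs : 0 ≤ s) : bellmanPsi p q y s ≤ 3 * (y ^ p + s ^ (q / 2)) := by
  obtain ⟨hq, he⟩ := conj_exponent hp hp2 hpq
  have h1 : 0 ≤ y ^ p := by positivity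
  have h3 : 0 ≤ s ^ (q / 2) := by positivity
  unfold bellmanPsi
  split_ifs with h
  · have h' := (rpow_le_iff_le_rpow hp hp2 hpq hy hs).1 h
    rcases hy.eq_or_lt with rfl | hy
    · rw [Real.zero_rpow (by linarith)] at h'
      rw [le_antisymm h' hs]
      simp only [mul_zero, ne_eq, OfNat.ofNat_ne_zero, not_false_eq_true, zero_pow, add_zero]
      positivity
    have e1 : y ^ (2 - p) * s ≤ y ^ p := by
      calc y ^ (2 - p) * s ≤ y ^ (2 - p) * y ^ (2 * p - 2) := by gcongr
        _ = y ^ p := by rw [← Real.rpow_add hy]; ring_nf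
    have e2 : y ^ (4 - 3 * p) * s ^ 2 ≤ y ^ p := by
      calc y ^ (4 - 3 * p) * s ^ 2 ≤ y ^ (4 - 3 * p) * (y ^ (2 * p - 2)) ^ 2 := by gcongr
        _ = y ^ p := by
          rw [← Real.rpow_natCast, ← Real.rpow_mul hy.le, ← Real.rpow_add hy]
          push_cast; ring_nf
    linarith
  · have h2 : 0 ≤ 6 / q := div_nonneg (by norm_num) (by linarith)
    have h4 : 6 / q ≤ 3 := by rw [div_le_iff₀ (by linarith)]; linarith
    nlinarith

-- Each branch is continuous on its relatively closed region away from the origin; at the origin the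
-- first branch is squeezed between `0` and `3(y^p + s^(q/2))`.
open Topology in
theorem continuousOn_bellmanPsi {p q : ℝ} (hp : 1 < p) (hp2 : p ≤ 2) (hpq : 1 / p + 1 / q = 1) :
    ContinuousOn (fun z : ℝ × ℝ => bellmanPsi p q z.1 z.2) (Ici 0 ×ˢ Ici 0) := by
  obtain ⟨hq, he⟩ := conj_exponent hp hp2 hpq
  have cp : Continuous fun z : ℝ × ℝ => z.1 ^ p :=
    (Real.continuous_rpow_const (by linarith)).comp continuous_fst
  have cq : Continuous fun z : ℝ × ℝ => z.2 ^ (q / 2) :=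
    (Real.continuous_rpow_const (by linarith)).comp continuous_snd
  have hQ : IsClosed (Ici (0 : ℝ) ×ˢ Ici (0 : ℝ)) := isClosed_Ici.prod isClosed_Ici
  rintro ⟨y, s⟩ ⟨hy, hs⟩
  simp only [mem_Ici] at hy hs
  have c₂ : ContinuousWithinAt (fun z : ℝ × ℝ => bellmanPsi p q z.1 z.2)
      ((Ici 0 ×ˢ Ici 0) ∩ {z | z.1 ^ p ≤ z.2 ^ (q / 2)}) (y, s) := by
    by_cases h : y ^ p ≤ s ^ (q / 2)
    · refine ContinuousWithinAt.congr
        (f := fun z : ℝ × ℝ => 6 / q * z.2 ^ (q / 2) + (2 - 6 / q) * z.1 ^ p) ?_ ?_ ?_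
      · exact ((continuous_const.mul cq).add (continuous_const.mul cp)).continuousWithinAt
      · exact fun z hz => bellmanPsi_of_ge hp hp2 hpq hz.1.1 hz.1.2 hz.2
      · exact bellmanPsi_of_ge hp hp2 hpq hy hs h
    · refine continuousWithinAt_of_notMem_closure ?_
      rw [(hQ.inter (isClosed_le cp cq)).closure_eq]
      exact fun hz => h hz.2
  have c₁ : ContinuousWithinAt (fun z : ℝ × ℝ => bellmanPsi p q z.1 z.2)
      ((Ici 0 ×ˢ Ici 0) ∩ {z | z.2 ^ (q / 2) ≤ z.1 ^ p}) (y, s) := by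
    by_cases h : s ^ (q / 2) ≤ y ^ p
    · rcases hy.eq_or_lt with rfl | hy
      · have h' := (rpow_le_iff_le_rpow hp hp2 hpq le_rfl hs).1 h
        rw [Real.zero_rpow (by linarith)] at h'
        obtain rfl := le_antisymm h' hs
        have e0 : bellmanPsi p q 0 0 = 0 := by rw [bellmanPsi, if_pos h]; simp
        refine tendsto_of_tendsto_of_tendsto_of_le_of_le' (g := fun _ => (0 : ℝ))
          (h := fun z : ℝ × ℝ => 3 * (z.1 ^ p + z.2 ^ (q / 2))) ?_ ?_ ?_ ?_
        · simp only [e0]; exact tendsto_const_nhds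
        · have : Filter.Tendsto (fun z : ℝ × ℝ => 3 * (z.1 ^ p + z.2 ^ (q / 2)))
              (𝓝 (0, 0)) (𝓝 (3 * ((0 : ℝ) ^ p + 0 ^ (q / 2)))) :=
            (continuous_const.mul (cp.add cq)).tendsto (0, 0)
          rw [Real.zero_rpow (by linarith), Real.zero_rpow (by linarith)] at this
          simp only [e0]
          simpa using this.mono_left nhdsWithin_le_nhds
        · exact eventually_nhdsWithin_of_forall fun z hz =>
            bellmanPsi_nonneg hp hp2 hpq hz.1.1 hz.1.2
        · exact eventually_nhdsWithin_of_forall fun z hz => bellmanPsi_le hp hp2 hpq hz.1.1 hz.1.2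
      · refine ContinuousWithinAt.congr
          (f := fun z : ℝ × ℝ => z.1 ^ (2 - p) * z.2 + z.1 ^ (4 - 3 * p) * z.2 ^ 2) ?_ ?_ ?_
        · refine ContinuousAt.continuousWithinAt ?_
          have a : ∀ r : ℝ, ContinuousAt (fun z : ℝ × ℝ => z.1 ^ r) (y, s) := fun r =>
            continuousAt_fst.rpow_const (Or.inl hy.ne')
          exact ((a _).mul continuousAt_snd).add ((a _).mul (continuousAt_snd.pow 2))
        · intro z hz
          exact if_pos hz.2
        · simp only [bellmanPsi]
          rw [if_pos h]
    · refine continuousWithinAt_of_notMem_closure ?_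
      rw [(hQ.inter (isClosed_le cq cp)).closure_eq]
      exact fun hz => h hz.2
  refine (c₁.union c₂).mono fun z hz => ?_
  rcases le_total (z.2 ^ (q / 2)) (z.1 ^ p) with h | h
  · exact Or.inl ⟨hz, h⟩
  · exact Or.inr ⟨hz, h⟩

/-- Along a segment whose interior lies in the open quadrant all real powers are smooth, and the
sign of `s^(q/2) - y^p` selects the branch. It may change sign many times, which the gluing
criterion allows. -/
theorem convexOn_segment_of_pos {p q y s e f : ℝ} (hp : 1 < p) (hp2 : p ≤ 2)
    (hpq : 1 / p + 1 / q = 1) (hy : ∀ x ∈ Ioo (0 : ℝ) 1, 0 < y + x * e)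
    (hs : ∀ x ∈ Ioo (0 : ℝ) 1, 0 < s + x * f)
    (hy' : ∀ x ∈ Icc (0 : ℝ) 1, 0 ≤ y + x * e) (hs' : ∀ x ∈ Icc (0 : ℝ) 1, 0 ≤ s + x * f) :
    ConvexOn ℝ (Icc 0 1) fun x => convexityConst p * (y + x * e) ^ p
      + bellmanPsi p q (y + x * e) (s + x * f) := by
  obtain ⟨hq, he⟩ := conj_exponent hp hp2 hpq
  have hK := convexityConst_ge hp
  set K := convexityConst p with hKdef
  have cY : Continuous fun x : ℝ => y + x * e := by fun_prop
  have cS : Continuous fun x : ℝ => s + x * f := by fun_prop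
  have dY : ∀ x, HasDerivAt (fun x : ℝ => y + x * e) e x := fun x => by
    simpa using ((hasDerivAt_id x).mul_const e).const_add y
  have dS : ∀ x, HasDerivAt (fun x : ℝ => s + x * f) f x := fun x => by
    simpa using ((hasDerivAt_id x).mul_const f).const_add s
  have rY : ∀ r : ℝ, ∀ x ∈ Ioo (0 : ℝ) 1,
      HasDerivAt (fun x : ℝ => (y + x * e) ^ r) (r * (y + x * e) ^ (r - 1) * e) x := fun r x hx =>
    ((dY x).rpow_const (Or.inl (hy x hx).ne')).congr_deriv (by ring)
  have rS : ∀ r : ℝ, ∀ x ∈ Ioo (0 : ℝ) 1,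
      HasDerivAt (fun x : ℝ => (s + x * f) ^ r) (r * (s + x * f) ^ (r - 1) * f) x := fun r x hx =>
    ((dS x).rpow_const (Or.inl (hs x hx).ne')).congr_deriv (by ring)
  have sS : ∀ x, HasDerivAt (fun x : ℝ => (s + x * f) ^ 2) (2 * (s + x * f) * f) x := fun x => by
    simpa [Pi.pow_def] using (dS x).pow 2
  refine convexOn_of_glued (φ := fun x => (s + x * f) ^ (q / 2) - (y + x * e) ^ p)
    (F₁ := fun x => K * (y + x * e) ^ p
      + ((y + x * e) ^ (2 - p) * (s + x * f) + (y + x * e) ^ (4 - 3 * p) * (s + x * f) ^ 2))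
    (F₁' := fun x => K * (p * (y + x * e) ^ (p - 1) * e)
      + (((2 - p) * (y + x * e) ^ (1 - p) * e * (s + x * f) + (y + x * e) ^ (2 - p) * f)
      + ((4 - 3 * p) * (y + x * e) ^ (3 - 3 * p) * e * (s + x * f) ^ 2
          + (y + x * e) ^ (4 - 3 * p) * (2 * (s + x * f) * f))))
    (F₁'' := fun x => K * (p * ((p - 1) * (y + x * e) ^ (p - 2) * e) * e)
      + ((2 - p) * ((1 - p) * (y + x * e) ^ (-p) * e) * e * (s + x * f)
          + (2 - p) * (y + x * e) ^ (1 - p) * e * f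
          + (2 - p) * (y + x * e) ^ (1 - p) * e * f)
      + ((4 - 3 * p) * ((3 - 3 * p) * (y + x * e) ^ (2 - 3 * p) * e) * e * (s + x * f) ^ 2
          + (4 - 3 * p) * (y + x * e) ^ (3 - 3 * p) * e * (2 * (s + x * f) * f)
          + ((4 - 3 * p) * (y + x * e) ^ (3 - 3 * p) * e * (2 * (s + x * f) * f)
            + (y + x * e) ^ (4 - 3 * p) * (2 * f * f))))
    (F₂ := fun x => K * (y + x * e) ^ p
      + (6 / q * (s + x * f) ^ (q / 2) + (2 - 6 / q) * (y + x * e) ^ p))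
    (F₂' := fun x => K * (p * (y + x * e) ^ (p - 1) * e)
      + (6 / q * (q / 2 * (s + x * f) ^ (q / 2 - 1) * f)
        + (2 - 6 / q) * (p * (y + x * e) ^ (p - 1) * e)))
    (F₂'' := fun x => K * (p * ((p - 1) * (y + x * e) ^ (p - 2) * e) * e)
      + (6 / q * (q / 2 * ((q / 2 - 1) * (s + x * f) ^ (q / 2 - 2) * f) * f)
        + (2 - 6 / q) * (p * ((p - 1) * (y + x * e) ^ (p - 2) * e) * e)))
    ?_ ?_ ?_ ?_ ?_ ?_ ?_ ?_ ?_ ?_ ?_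
  · refine ContinuousOn.add (continuousOn_const.mul
      (cY.continuousOn.rpow_const fun x hx => Or.inr (by linarith))) ?_
    exact (continuousOn_bellmanPsi hp hp2 hpq).comp (f := fun x => (y + x * e, s + x * f))
      (by fun_prop) fun x hx => ⟨hy' x hx, hs' x hx⟩
  · exact (cS.continuousOn.rpow_const fun x hx => Or.inr (by linarith)).sub
      (cY.continuousOn.rpow_const fun x hx => Or.inr (by linarith))
  · intro x hx h
    simp only [bellmanPsi]
    rw [if_pos (by linarith)]
  · intro x hx h
    rw [bellmanPsi_of_ge hp hp2 hpq (hy x hx).le (hs x hx).le (by linarith)]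
  · intro x hx
    refine ((rY p x hx).const_mul K).add ((((rY (2 - p) x hx).mul (dS x)).add
      ((rY (4 - 3 * p) x hx).mul (sS x))).congr_deriv ?_)
    rw [show 2 - p - 1 = 1 - p by ring, show 4 - 3 * p - 1 = 3 - 3 * p by ring]
  · intro x hx
    exact ((rY p x hx).const_mul K).add (((rS (q / 2) x hx).const_mul _).add
      ((rY p x hx).const_mul _))
  · intro x hx
    have a1 := (((rY (p - 1) x hx).const_mul p).mul_const e).const_mul K
    have a2 := ((((rY (1 - p) x hx).const_mul (2 - p)).mul_const e).mul (dS x)).add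
      ((rY (2 - p) x hx).mul_const f)
    have a3 := ((((rY (3 - 3 * p) x hx).const_mul (4 - 3 * p)).mul_const e).mul (sS x)).add
      ((rY (4 - 3 * p) x hx).mul (((dS x).const_mul 2).mul_const f))
    refine (a1.add (a2.add a3)).congr_deriv ?_
    rw [show p - 1 - 1 = p - 2 by ring, show 2 - p - 1 = 1 - p by ring,
      show 4 - 3 * p - 1 = 3 - 3 * p by ring, show 1 - p - 1 = - p by ring,
      show 3 - 3 * p - 1 = 2 - 3 * p by ring]
    ring
  · intro x hx
    have a1 := ((rY (p - 1) x hx).const_mul p).mul_const e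
    have a2 := (((rS (q / 2 - 1) x hx).const_mul (q / 2)).mul_const f).const_mul (6 / q)
    refine ((a1.const_mul K).add (a2.add (a1.const_mul (2 - 6 / q)))).congr_deriv ?_
    rw [show p - 1 - 1 = p - 2 by ring, show q / 2 - 1 - 1 = q / 2 - 2 by ring]
  · intro x hx h
    exact hessian_nonneg_of_le hp hp2 (hy x hx) (hs x hx)
      ((rpow_le_iff_le_rpow hp hp2 hpq (hy x hx).le (hs x hx).le).1 (by linarith))
  · intro x hx h
    have h1 : 0 ≤ (y + x * e) ^ (p - 2) := Real.rpow_nonneg (hy x hx).le _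
    have h2 : 0 ≤ (s + x * f) ^ (q / 2 - 2) := Real.rpow_nonneg (hs x hx).le _
    have h3 : 0 ≤ K + (2 - 6 / q) := by
      have : 6 / q ≤ 3 := by rw [div_le_iff₀ (by linarith)]; linarith
      linarith
    have : K * (p * ((p - 1) * (y + x * e) ^ (p - 2) * e) * e)
      + (6 / q * (q / 2 * ((q / 2 - 1) * (s + x * f) ^ (q / 2 - 2) * f) * f)
        + (2 - 6 / q) * (p * ((p - 1) * (y + x * e) ^ (p - 2) * e) * e))
      = (K + (2 - 6 / q)) * p * (p - 1) * (y + x * e) ^ (p - 2) * e ^ 2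
        + 6 / q * (q / 2) * (q / 2 - 1) * (s + x * f) ^ (q / 2 - 2) * f ^ 2 := by ring
    rw [this]
    have h4 : 0 ≤ p - 1 := by linarith
    have h5 : 0 ≤ q / 2 - 1 := by linarith
    have h6 : 0 ≤ q := by linarith
    positivity
  -- The directional derivatives of the two branches agree on the interface: substitute `s =
  -- y^(2p-2)`.
  · intro x hx h
    have hY := hy x hx
    have hS := hs x hx
    set Y := y + x * e with hYdef
    set S := s + x * f with hSdef
    have hSY : S = Y ^ (2 * p - 2) := by
      have h' : S ^ (q / 2) = Y ^ p := by linarith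
      rw [← he, Real.rpow_mul hY.le] at h'
      exact (Real.rpow_left_inj hS.le (by positivity) (by linarith)).1 h'
    have hq0 : q ≠ 0 := by linarith
    have e1 : Y ^ (1 - p) * S = Y ^ (p - 1) := by
      rw [hSY, ← Real.rpow_add hY]; ring_nf
    have e2 : Y ^ (3 - 3 * p) * S ^ 2 = Y ^ (p - 1) := by
      rw [hSY, ← Real.rpow_natCast, ← Real.rpow_mul hY.le, ← Real.rpow_add hY]
      push_cast; ring_nf
    have e3 : Y ^ (4 - 3 * p) * S = Y ^ (2 - p) := by
      rw [hSY, ← Real.rpow_add hY]; ring_nf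
    have e4 : S ^ (q / 2 - 1) = Y ^ (2 - p) := by
      rw [hSY, ← Real.rpow_mul hY.le, mul_sub, he]; ring_nf
    have e5 : 6 / q * (q / 2) = 3 := by field_simp; norm_num
    have e6 : (2 - 6 / q) * p = 6 - 4 * p := by
      have : p ≠ 0 := by linarith
      field_simp at hpq ⊢
      linarith
    rw [e4]
    linear_combination ((2 - p) * e) * e1 + (4 - 3 * p) * e * e2 + 2 * f * e3
      - Y ^ (2 - p) * f * e5 - Y ^ (p - 1) * e * e6

theorem bellmanPsi_zero_left {p q s : ℝ} (hp : 1 < p) (hp2 : p ≤ 2) (hpq : 1 / p + 1 / q = 1)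
    (hs : 0 ≤ s) : bellmanPsi p q 0 s = 6 / q * s ^ (q / 2) := by
  rw [bellmanPsi_of_ge hp hp2 hpq le_rfl hs, Real.zero_rpow (by linarith), mul_zero, add_zero]
  rw [Real.zero_rpow (by linarith)]
  positivity

theorem bellmanPsi_zero_right {p q y : ℝ} (hp : 1 < p) (hp2 : p ≤ 2) (hpq : 1 / p + 1 / q = 1)
    (hy : 0 ≤ y) : bellmanPsi p q y 0 = 0 := by
  obtain ⟨hq, -⟩ := conj_exponent hp hp2 hpq
  rw [bellmanPsi, if_pos]
  · simp
  · rw [Real.zero_rpow (by linarith)]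
    positivity

/-- The perturbation term with a multiple of `y ^ p` added is jointly convex. -/
theorem convexOn_add_bellmanPsi {p q : ℝ} (hp : 1 < p) (hp2 : p ≤ 2) (hpq : 1 / p + 1 / q = 1) :
    ConvexOn ℝ (Ici (0 : ℝ) ×ˢ Ici (0 : ℝ))
      fun z => convexityConst p * z.1 ^ p + bellmanPsi p q z.1 z.2 := by
  obtain ⟨hq, -⟩ := conj_exponent hp hp2 hpq
  have hK := convexityConst_ge hp
  have hconv := (convex_Ici (𝕜 := ℝ) (0 : ℝ)).prod (convex_Ici (𝕜 := ℝ) (0 : ℝ))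
  refine ⟨hconv, ?_⟩
  rintro ⟨y₀, s₀⟩ ⟨hy₀, hs₀⟩ ⟨y₁, s₁⟩ ⟨hy₁, hs₁⟩ a b ha hb hab
  simp only [mem_Ici] at hy₀ hs₀ hy₁ hs₁
  simp only [Prod.smul_mk, Prod.mk_add_mk, smul_eq_mul]
  -- A segment lying in a coordinate axis is treated directly, since the function is a multiple of
  -- one convex power there. Every other segment has its relative interior in the open quadrant.
  rcases (add_nonneg hy₀ hy₁).eq_or_lt with h | h
  · have h0 : y₀ = 0 := by linarith
    have h1 : y₁ = 0 := by linarith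
    subst h0 h1
    have := (convexOn_rpow (p := q / 2) (by linarith)).2 hs₀ hs₁ ha hb hab
    simp only [smul_eq_mul] at this
    simp only [mul_zero, add_zero]
    rw [bellmanPsi_zero_left hp hp2 hpq hs₀, bellmanPsi_zero_left hp hp2 hpq hs₁,
      bellmanPsi_zero_left hp hp2 hpq (by positivity), Real.zero_rpow (by linarith)]
    have h6 : 0 ≤ 6 / q := div_nonneg (by norm_num) (by linarith)
    nlinarith [mul_le_mul_of_nonneg_left this h6]
  rcases (add_nonneg hs₀ hs₁).eq_or_lt with h' | h'
  · have h0 : s₀ = 0 := by linarith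
    have h1 : s₁ = 0 := by linarith
    subst h0 h1
    have := (convexOn_rpow (p := p) (by linarith)).2 hy₀ hy₁ ha hb hab
    simp only [smul_eq_mul] at this
    simp only [mul_zero, add_zero]
    rw [bellmanPsi_zero_right hp hp2 hpq hy₀, bellmanPsi_zero_right hp hp2 hpq hy₁,
      bellmanPsi_zero_right hp hp2 hpq (by positivity)]
    nlinarith [mul_le_mul_of_nonneg_left this (by linarith : 0 ≤ convexityConst p)]
  have pos : ∀ u v : ℝ, 0 ≤ u → 0 ≤ v → 0 < u + v → ∀ x ∈ Ioo (0 : ℝ) 1, 0 < u + x * (v - u) := by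
    intro u v hu hv huv x hx
    have h1 : u + x * (v - u) = (1 - x) * u + x * v := by ring
    rw [h1]
    have h2 : 0 < 1 - x := by linarith [hx.2]
    rcases hu.eq_or_lt with rfl | hu
    · have : 0 < v := by linarith
      have := mul_pos hx.1 this
      linarith
    · have := mul_pos h2 hu
      have := mul_nonneg hx.1.le hv
      linarith
  have nn : ∀ u v : ℝ, 0 ≤ u → 0 ≤ v → ∀ x ∈ Icc (0 : ℝ) 1, 0 ≤ u + x * (v - u) := by
    intro u v hu hv x hx
    have h1 : u + x * (v - u) = (1 - x) * u + x * v := by ring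
    rw [h1]
    exact add_nonneg (mul_nonneg (by linarith [hx.2]) hu) (mul_nonneg hx.1 hv)
  have := (convexOn_segment_of_pos hp hp2 hpq (pos y₀ y₁ hy₀ hy₁ h) (pos s₀ s₁ hs₀ hs₁ h')
    (nn y₀ y₁ hy₀ hy₁) (nn s₀ s₁ hs₀ hs₁)).2 (x := 0) (y := 1) (by simp) (by simp) ha hb hab
  simp only [smul_eq_mul, mul_zero, mul_one, zero_add, zero_mul, add_zero, one_mul,
    add_sub_cancel] at this
  have e1 : ∀ u v : ℝ, u + b * (v - u) = a * u + b * v := fun u v => by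
    have : a = 1 - b := by linarith
    rw [this]; ring
  rwa [e1, e1] at this

/-- A convex function on the half-line with its minimum at the origin is nondecreasing. -/
theorem ConvexOn.monotoneOn_of_min_zero {f : ℝ → ℝ} (hf : ConvexOn ℝ (Ici 0) f)
    (h0 : ∀ x, 0 ≤ x → f 0 ≤ f x) : MonotoneOn f (Ici 0) := by
  intro x hx y hy hxy
  simp only [mem_Ici] at hx hy
  rcases hy.eq_or_lt with rfl | hy
  · rw [le_antisymm hxy hx]
  have h1 : (1 - x / y) • (0 : ℝ) + (x / y) • y = x := by
    simp only [smul_eq_mul]; field_simp; ring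
  have h2 : x / y ≤ 1 := (div_le_one hy).2 hxy
  have := hf.2 (mem_Ici.2 le_rfl) (mem_Ici.2 hy.le) (sub_nonneg.2 h2) (div_nonneg hx hy.le)
    (by ring)
  rw [h1] at this
  simp only [smul_eq_mul] at this
  nlinarith [h0 y hy.le, mul_nonneg (sub_nonneg.2 h2) (sub_nonneg.2 (h0 y hy.le))]

/-- Needed because `‖a‖` is only bounded by the mean of `‖a + d‖` and `‖a - d‖`. Convexity in `y`
reduces the claim to a minimum at `y = 0`. -/
theorem monotoneOn_add_bellmanPsi_left {p q s : ℝ} (hp : 1 < p) (hp2 : p ≤ 2)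
    (hpq : 1 / p + 1 / q = 1) (hs : 0 ≤ s) :
    MonotoneOn (fun y => convexityConst p * y ^ p + bellmanPsi p q y s) (Ici 0) := by
  obtain ⟨hq, -⟩ := conj_exponent hp hp2 hpq
  have hK := convexityConst_ge hp
  have h6 : 6 / q ≤ 3 := by rw [div_le_iff₀ (by linarith)]; linarith
  refine ConvexOn.monotoneOn_of_min_zero ?_ ?_
  · refine ⟨convex_Ici 0, fun x hx y hy a b ha hb hab => ?_⟩
    have := (convexOn_add_bellmanPsi hp hp2 hpq).2 (x := (x, s)) (y := (y, s)) ⟨hx, hs⟩ ⟨hy, hs⟩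
      ha hb hab
    simp only [Prod.smul_mk, Prod.mk_add_mk, smul_eq_mul] at this
    rw [← add_mul, hab, one_mul] at this
    exact this
  · intro y hy
    rw [bellmanPsi_zero_left hp hp2 hpq hs, Real.zero_rpow (by linarith), mul_zero, zero_add]
    have h1 : 0 ≤ y ^ p := by positivity
    have h2 : 0 ≤ s ^ (q / 2) := by positivity
    rcases le_total (s ^ (q / 2)) (y ^ p) with h | h
    · have := bellmanPsi_nonneg hp hp2 hpq hy hs
      nlinarith
    · rw [bellmanPsi_of_ge hp hp2 hpq hy hs h]
      nlinarith

theorem convexOn_bellmanPsi_right {p q y : ℝ} (hp : 1 < p) (hp2 : p ≤ 2)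
    (hpq : 1 / p + 1 / q = 1) (hy : 0 ≤ y) : ConvexOn ℝ (Ici 0) (bellmanPsi p q y) := by
  refine ⟨convex_Ici 0, fun s hs t ht a b ha hb hab => ?_⟩
  have := (convexOn_add_bellmanPsi hp hp2 hpq).2 (x := (y, s)) (y := (y, t)) ⟨hy, hs⟩ ⟨hy, ht⟩
    ha hb hab
  simp only [Prod.smul_mk, Prod.mk_add_mk, smul_eq_mul] at this
  rw [← add_mul, hab, one_mul] at this
  simp only [smul_eq_mul]
  have e : convexityConst p * y ^ p = a * (convexityConst p * y ^ p)
    + b * (convexityConst p * y ^ p) := by rw [← add_mul, hab, one_mul]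
  linarith

theorem bellmanPsi_mono_right {p q y s m : ℝ} (hp : 1 < p) (hp2 : p ≤ 2)
    (hpq : 1 / p + 1 / q = 1) (hy : 0 ≤ y) (hs : 0 ≤ s) (hsm : s ≤ m) :
    bellmanPsi p q y s ≤ bellmanPsi p q y m :=
  (convexOn_bellmanPsi_right hp hp2 hpq hy).monotoneOn_of_min_zero
    (fun x hx => by
      rw [bellmanPsi_zero_right hp hp2 hpq hy]
      exact bellmanPsi_nonneg hp hp2 hpq hy hx) hs (hs.trans hsm) hsm

/-- By convexity in `s`, the chord over `[s, m]` is at least as steep as the one over `[0, m]`,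
hence as the one over `[0, u]`. The choice of `u` keeps the last chord on the first branch, whose
linear term already has slope `y^(2-p)`. -/
theorem bellmanPsi_sub_ge {p q y s m : ℝ} (hp : 1 < p) (hp2 : p ≤ 2)
    (hpq : 1 / p + 1 / q = 1) (hy : 0 < y) (hs : 0 ≤ s) (hsm : s ≤ m) :
    y ^ (2 - p) * (m - s) ≤ bellmanPsi p q y m - bellmanPsi p q y s := by
  rcases hsm.eq_or_lt with rfl | hsm
  · simp
  have hc := convexOn_bellmanPsi_right hp hp2 hpq hy.le
  have hm : 0 < m := hs.trans_lt hsm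
  set u := min m (y ^ (2 * p - 2)) with hu
  have u0 : 0 < u := lt_min hm (Real.rpow_pos_of_pos hy _)
  have z0 := bellmanPsi_zero_right hp hp2 hpq hy.le
  have hu1 : y ^ (2 - p) ≤ (bellmanPsi p q y u - bellmanPsi p q y 0) / (u - 0) := by
    rw [z0, sub_zero, sub_zero, le_div_iff₀ u0, bellmanPsi,
      if_pos ((rpow_le_iff_le_rpow hp hp2 hpq hy.le u0.le).2 (min_le_right _ _))]
    have : 0 ≤ y ^ (4 - 3 * p) * u ^ 2 := by positivity
    linarith
  have hu2 : (bellmanPsi p q y u - bellmanPsi p q y 0) / (u - 0)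
      ≤ (bellmanPsi p q y m - bellmanPsi p q y 0) / (m - 0) :=
    hc.secant_mono (a := 0) (by simp) u0.le hm.le u0.ne' hm.ne' (min_le_left _ _)
  have hu3 : (bellmanPsi p q y m - bellmanPsi p q y 0) / (m - 0)
      ≤ (bellmanPsi p q y m - bellmanPsi p q y s) / (m - s) := by
    have := hc.secant_mono (a := m) (x := 0) (y := s) hm.le (by simp) hs hm.ne hsm.ne hs
    rw [← neg_div_neg_eq, neg_sub, neg_sub] at this
    rwa [← neg_div_neg_eq (_ - bellmanPsi p q y m), neg_sub, neg_sub] at this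
  have := hu1.trans (hu2.trans hu3)
  rwa [le_div_iff₀ (sub_pos.2 hsm)] at this

/-! ### The concavity inequality for the Bellman candidate -/

/-- Quantitative uniform convexity of `a ↦ ‖a‖ ^ p`, `1 < p ≤ 2`, in an inner product space. -/
theorem rpow_norm_uniform_convex {H : Type*} [NormedAddCommGroup H] [InnerProductSpace ℝ H]
    {p : ℝ} (hp : 1 < p) (hp2 : p ≤ 2) (a d : H) (hR : 0 < ‖a‖ + ‖d‖) :
    ‖a‖ ^ p + p * (p - 1) / 2 * (‖a‖ + ‖d‖) ^ (p - 2) * ‖d‖ ^ 2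
      ≤ (‖a + d‖ ^ p + ‖a - d‖ ^ p) / 2 := by
  set R := ‖a‖ + ‖d‖ with hRdef
  set k := p * (p - 1) / 2 * R ^ (p - 2) with hk
  have hR0 : 0 < R ^ (p - 2) := Real.rpow_pos_of_pos hR _
  -- With this `k`, `g` is convex and nondecreasing on `[0, R]`, an interval containing all the
  -- norms involved. The parallelogram law then turns the subtracted `k z²` into the gain `k ‖d‖²`.
  set g : ℝ → ℝ := fun z => z ^ p - k * z ^ 2 with hg
  have hge : ∀ z ∈ Ioo 0 R, R ^ (p - 2) ≤ z ^ (p - 2) := fun z hz =>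
    Real.rpow_le_rpow_of_nonpos hz.1 hz.2.le (by linarith)
  have hd : ∀ z ∈ Ioo 0 R, HasDerivAt g (p * z ^ (p - 1) - k * (2 * z)) z := fun z hz => by
    refine (Real.hasDerivAt_rpow_const (Or.inl hz.1.ne')).sub (HasDerivAt.const_mul k ?_)
    simpa using hasDerivAt_pow 2 z
  have hdd : ∀ z ∈ Ioo 0 R, HasDerivAt (fun z => p * z ^ (p - 1) - k * (2 * z))
      (p * ((p - 1) * z ^ (p - 2)) - k * 2) z := fun z hz => by
    refine (((Real.hasDerivAt_rpow_const (Or.inl hz.1.ne')).const_mul p).sub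
      (((hasDerivAt_id z).const_mul 2).const_mul k)).congr_deriv ?_
    rw [show p - 1 - 1 = p - 2 by ring, mul_one]
  have hgc : ContinuousOn g (Icc 0 R) := by
    refine ContinuousOn.sub ?_ (by fun_prop)
    exact (Real.continuous_rpow_const (by linarith)).continuousOn
  have hcv : ConvexOn ℝ (Icc 0 R) g := by
    refine convexOn_of_hasDerivWithinAt2_nonneg (convex_Icc 0 R) hgc
      (f' := fun z => p * z ^ (p - 1) - k * (2 * z))
      (f'' := fun z => p * ((p - 1) * z ^ (p - 2)) - k * 2) ?_ ?_ ?_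
    all_goals rw [interior_Icc]
    · exact fun z hz => (hd z hz).hasDerivWithinAt
    · exact fun z hz => (hdd z hz).hasDerivWithinAt
    · intro z hz
      have := mul_le_mul_of_nonneg_left (hge z hz) (by nlinarith : 0 ≤ p * (p - 1))
      simp only [hk]; nlinarith
  have hmono : MonotoneOn g (Icc 0 R) := by
    refine monotoneOn_of_hasDerivWithinAt_nonneg (convex_Icc 0 R) hgc
      (f' := fun z => p * z ^ (p - 1) - k * (2 * z)) ?_ ?_
    all_goals rw [interior_Icc]
    · exact fun z hz => (hd z hz).hasDerivWithinAt
    · intro z hz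
      have e : z ^ (p - 1) = z ^ (p - 2) * z := by
        rw [← Real.rpow_add_one hz.1.ne']; ring_nf
      simp only [hk, e]
      have h1 := mul_le_mul_of_nonneg_right (hge z hz) hz.1.le
      have h2 : 0 ≤ R ^ (p - 2) * z := mul_nonneg hR0.le hz.1.le
      nlinarith [mul_le_mul_of_nonneg_left h1 (by linarith : 0 ≤ p),
        mul_nonneg (by nlinarith : 0 ≤ p * (2 - p)) h2]
  have m₁ : ‖a + d‖ ∈ Icc 0 R := ⟨norm_nonneg _, norm_add_le _ _⟩
  have m₂ : ‖a - d‖ ∈ Icc 0 R := ⟨norm_nonneg _, norm_sub_le _ _⟩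
  have hc := hcv.2 m₁ m₂ (by norm_num : (0 : ℝ) ≤ 1 / 2) (by norm_num : (0 : ℝ) ≤ 1 / 2)
    (by norm_num)
  have hle : ‖a‖ ≤ (1 / 2 : ℝ) • ‖a + d‖ + (1 / 2 : ℝ) • ‖a - d‖ := by
    have h1 : (2 : ℝ) • a = (a + d) + (a - d) := by rw [two_smul]; abel
    have h2 := norm_add_le (a + d) (a - d)
    rw [← h1, norm_smul] at h2
    simp only [Real.norm_ofNat] at h2
    simp only [smul_eq_mul]; linarith
  have hm := hmono ⟨norm_nonneg a, by linarith [norm_nonneg d]⟩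
    ((convex_Icc 0 R) m₁ m₂ (by norm_num) (by norm_num) (by norm_num)) hle
  have par := parallelogram_law_with_norm ℝ a d
  have := hm.trans hc
  simp only [hg, smul_eq_mul] at this
  linear_combination this - k / 2 * par

theorem bellmanZero_one {p q δ y s x₃ x₄ : ℝ} (hp : 1 < p) (hpq : 1 / p + 1 / q = 1) :
    bellmanZero p q 1 δ y s x₃ x₄
      = 2 * (x₃ + x₄) - y ^ p - s ^ (q / 2) - δ * bellmanPsi p q y s := by
  unfold bellmanZero bellmanPsi
  congr 2
  split_ifs with h
  · rw [show 2 - p - 2 * 1 * (p - 1) = 4 - 3 * p by ring, show (1 : ℝ) + 1 = (2 : ℕ) by norm_num,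
      Real.rpow_natCast]
  · have e : 2 / p * (2 - p - 1 * (p - 1)) = 2 - 6 / q := by
      have : p ≠ 0 := by linarith
      have h1 : 1 / q = 1 - 1 / p := by linarith
      rw [div_eq_mul_one_div 6 q, h1]
      field_simp
      ring
    rw [e]; ring

/-- If `h ≤ x`, then `x + h` is comparable to `x` and weighted AM-GM pairs `x^(p-2) h²` with
`x^(2-p) D²`. If `x ≤ h`, then `(x + h)^(p-2) h²` is comparable to `h^p` and Young's inequality
pairs it with `|D|^q`. -/
theorem min_mul_le_of_growth {p q : ℝ} (hp : 1 < p) (hp2 : p ≤ 2) (hpq : 1 / p + 1 / q = 1)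
    {κ δ x h D M Ψ : ℝ} (hκ0 : 0 < κ) (hκ1 : κ ≤ 1) (hδ0 : 0 < δ) (h0 : 0 ≤ h)
    (hR : 0 < x + h) (c3 : |D| ^ q ≤ M) (c4 : 0 ≤ Ψ) (c6 : 0 < x → x ^ (2 - p) * D ^ 2 ≤ Ψ) :
    min κ δ * (h * |D|) ≤ 2 * κ * ((x + h) ^ (p - 2) * h ^ 2) + M + δ * Ψ := by
  obtain ⟨hq, he⟩ := conj_exponent hp hp2 hpq
  have hDq : 0 ≤ |D| ^ q := by positivity
  set R := x + h with hRdef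
  set X := R ^ (p - 2) * h ^ 2 with hX
  have X0 : 0 ≤ X := by positivity
  have two_pow : ∀ z : ℝ, 0 < z → z ^ (p - 2) ≤ 2 * (2 * z) ^ (p - 2) := by
    intro z hz
    rw [Real.mul_rpow (by norm_num) hz.le, ← mul_assoc]
    refine le_mul_of_one_le_left (by positivity) ?_
    have : (2 : ℝ) ^ (p - 1) = 2 * 2 ^ (p - 2) := by
      rw [← Real.rpow_one_add' (by norm_num) (by linarith)]; ring_nf
    rw [← this]
    exact Real.one_le_rpow (by norm_num) (by linarith)
  rcases le_total h x with hhx | hhx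
  · have hxpos : 0 < x := by linarith
    have c6 := c6 hxpos
    have hRx : x ^ (p - 2) ≤ 2 * R ^ (p - 2) := by
      refine (two_pow x hxpos).trans ?_
      have : (2 * x) ^ (p - 2) ≤ R ^ (p - 2) :=
        Real.rpow_le_rpow_of_nonpos hR (by linarith) (by linarith)
      linarith
    set A := x ^ (p - 2) with hA
    set B := x ^ (2 - p) with hB
    have hAB : A * B = 1 := by
      rw [hA, hB, ← Real.rpow_add hxpos]; simp
    have hA0 : 0 < A := Real.rpow_pos_of_pos hxpos _
    have hB0 : 0 < B := Real.rpow_pos_of_pos hxpos _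
    have hX1 : A * h ^ 2 ≤ 2 * X := by
      rw [hX, ← mul_assoc]; exact mul_le_mul_of_nonneg_right hRx (sq_nonneg _)
    have amgm : h * |D| ≤ A * h ^ 2 + B * D ^ 2 := by
      have h1 : 0 ≤ A * (h - B * |D| / 2) ^ 2 := by positivity
      have h2 : A * (h - B * |D| / 2) ^ 2 = A * h ^ 2 - (A * B) * (h * |D|)
        + (A * B) * B * |D| ^ 2 / 4 := by ring
      rw [h2, hAB, sq_abs] at h1
      have h3 := mul_nonneg hB0.le (sq_nonneg D)
      linarith
    have m1 : min κ δ ≤ κ := min_le_left _ _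
    have m2 : min κ δ ≤ δ := min_le_right _ _
    have m0 : 0 < min κ δ := lt_min hκ0 hδ0
    have i1 : min κ δ * (A * h ^ 2) ≤ κ * (2 * X) :=
      mul_le_mul m1 hX1 (by positivity) hκ0.le
    have i2 : min κ δ * (B * D ^ 2) ≤ δ * Ψ :=
      mul_le_mul m2 c6 (by positivity) hδ0.le
    have i3 := mul_le_mul_of_nonneg_left amgm m0.le
    have i4 : 0 ≤ M := hDq.trans c3
    linarith
  · have hhpos : 0 < h := by linarith
    have hXh : h ^ p ≤ 2 * X := by
      have h1 : (2 * h) ^ (p - 2) ≤ R ^ (p - 2) :=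
        Real.rpow_le_rpow_of_nonpos hR (by linarith) (by linarith)
      have h2 : h ^ p = h ^ (p - 2) * h ^ 2 := by
        rw [← Real.rpow_natCast, ← Real.rpow_add hhpos]; push_cast; ring_nf
      have h3 := two_pow h hhpos
      rw [h2, hX, ← mul_assoc]
      exact mul_le_mul_of_nonneg_right (by linarith) (sq_nonneg _)
    have young := Real.young_inequality_of_nonneg h0 (abs_nonneg D)
      (Real.holderConjugate_iff.2 ⟨hp, by simpa using hpq⟩ : p.HolderConjugate q)
    have hhp : 0 ≤ h ^ p := by positivity
    have young' : h * |D| ≤ h ^ p + |D| ^ q := by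
      have h1 : h ^ p / p ≤ h ^ p := div_le_self hhp hp.le
      have h2 : |D| ^ q / q ≤ |D| ^ q := div_le_self hDq (by linarith)
      linarith
    have m1 : min κ δ ≤ κ := min_le_left _ _
    have m0 : 0 < min κ δ := lt_min hκ0 hδ0
    have i1 : min κ δ * h ^ p ≤ κ * (2 * X) := mul_le_mul m1 hXh hhp hκ0.le
    have i2 : min κ δ * |D| ^ q ≤ 1 * |D| ^ q := mul_le_mul_of_nonneg_right (by linarith) hDq
    have i3 := mul_le_mul_of_nonneg_left young' m0.le
    have i4 := mul_le_mul_of_nonneg_left c4 hδ0.le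
    linarith

/-- Strict convexity of the main part of the Bellman candidate, in a quantitative form. -/
theorem bellman_main_inequality {H : Type*} [NormedAddCommGroup H] [InnerProductSpace ℝ H]
    {p q : ℝ} (hp : 1 < p) (hp2 : p ≤ 2) (hpq : 1 / p + 1 / q = 1) {δ : ℝ}
    (hδ : δ * (2 * convexityConst p) = 1) (a d : H) (s s₁ s₂ D : ℝ) (hs : 0 ≤ s) (hs₁ : 0 ≤ s₁)
    (hs₂ : 0 ≤ s₂) (hD : (s₁ + s₂) / 2 = s + D ^ 2) :
    min (p * (p - 1) / 8) δ * (‖d‖ * |D|) + (‖a‖ ^ p + s ^ (q / 2) + δ * bellmanPsi p q ‖a‖ s)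
      ≤ ((‖a + d‖ ^ p + s₁ ^ (q / 2) + δ * bellmanPsi p q ‖a + d‖ s₁)
        + (‖a - d‖ ^ p + s₂ ^ (q / 2) + δ * bellmanPsi p q ‖a - d‖ s₂)) / 2 := by
  obtain ⟨hq, he⟩ := conj_exponent hp hp2 hpq
  have hK := convexityConst_ge hp
  have hδ0 : 0 < δ := by
    by_contra h
    nlinarith
  have hδ1 : δ ≤ 1 := by nlinarith
  set κ := p * (p - 1) / 8 with hκ
  have hκ0 : 0 < κ := by 
    have : 0 < p * (p - 1) := mul_pos (by linarith) (by linarith)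
    positivity
  have hκ1 : κ ≤ 1 := by rw [hκ]; nlinarith
  set m := s + D ^ 2 with hm
  have hm0 : 0 ≤ m := by positivity
  have hsm : s ≤ m := by rw [hm]; nlinarith [sq_nonneg D]
  -- convexity of the perturbed part
  have c1 : convexityConst p * ‖a‖ ^ p + bellmanPsi p q ‖a‖ m ≤
      ((convexityConst p * ‖a + d‖ ^ p + bellmanPsi p q ‖a + d‖ s₁)
        + (convexityConst p * ‖a - d‖ ^ p + bellmanPsi p q ‖a - d‖ s₂)) / 2 := by
    have hle : ‖a‖ ≤ (1 / 2 : ℝ) * ‖a + d‖ + (1 / 2 : ℝ) * ‖a - d‖ := by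
      have h1 : (2 : ℝ) • a = (a + d) + (a - d) := by rw [two_smul]; abel
      have h2 := norm_add_le (a + d) (a - d)
      rw [← h1, norm_smul] at h2
      simp only [Real.norm_ofNat] at h2
      linarith
    have h1 := monotoneOn_add_bellmanPsi_left hp hp2 hpq hm0 (norm_nonneg a)
      (mem_Ici.2 ((norm_nonneg a).trans hle)) hle
    have h2 := (convexOn_add_bellmanPsi hp hp2 hpq).2 (x := (‖a + d‖, s₁)) (y := (‖a - d‖, s₂))
      ⟨norm_nonneg _, hs₁⟩ ⟨norm_nonneg _, hs₂⟩ (by norm_num : (0 : ℝ) ≤ 1 / 2)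
      (by norm_num : (0 : ℝ) ≤ 1 / 2) (by norm_num)
    simp only [Prod.smul_mk, Prod.mk_add_mk, smul_eq_mul] at h2
    rw [show 1 / 2 * s₁ + 1 / 2 * s₂ = m by linarith] at h2
    have := h1.trans h2
    linarith
  have c2 : m ^ (q / 2) ≤ (s₁ ^ (q / 2) + s₂ ^ (q / 2)) / 2 := by
    have := (convexOn_rpow (p := q / 2) (by linarith)).2 hs₁ hs₂ (by norm_num : (0 : ℝ) ≤ 1 / 2)
      (by norm_num : (0 : ℝ) ≤ 1 / 2) (by norm_num)
    simp only [smul_eq_mul] at this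
    rw [show 1 / 2 * s₁ + 1 / 2 * s₂ = m by linarith] at this
    linarith
  -- growth in the second variable
  have c3 : |D| ^ q ≤ m ^ (q / 2) - s ^ (q / 2) := by
    have := Real.add_rpow_le_rpow_add hs (sq_nonneg D) (p := q / 2) (by linarith)
    rw [← hm] at this
    have e : (D ^ 2) ^ (q / 2) = |D| ^ q := by
      rw [← sq_abs, ← Real.rpow_natCast, ← Real.rpow_mul (abs_nonneg D)]
      congr 1; push_cast; ring
    linarith
  have c4 := bellmanPsi_mono_right hp hp2 hpq (norm_nonneg a) hs hsm
  have hDq : 0 ≤ |D| ^ q := by positivity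
  have hcomb : δ * (convexityConst p * ‖a‖ ^ p + bellmanPsi p q ‖a‖ m) ≤
      δ * (((convexityConst p * ‖a + d‖ ^ p + bellmanPsi p q ‖a + d‖ s₁)
        + (convexityConst p * ‖a - d‖ ^ p + bellmanPsi p q ‖a - d‖ s₂)) / 2) :=
    mul_le_mul_of_nonneg_left c1 hδ0.le
  have hδK : δ * convexityConst p = 1 / 2 := by linarith
  -- Since `δ K = 1/2`, only half of `‖a‖^p` is spent here; the other half supplies the uniform
  -- convexity gain.
  have hcomb' : ‖a‖ ^ p / 2 + δ * bellmanPsi p q ‖a‖ m ≤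
      (‖a + d‖ ^ p / 2 + δ * bellmanPsi p q ‖a + d‖ s₁
        + (‖a - d‖ ^ p / 2 + δ * bellmanPsi p q ‖a - d‖ s₂)) / 2 := by
    linear_combination hcomb + (‖a + d‖ ^ p / 2 + ‖a - d‖ ^ p / 2 - ‖a‖ ^ p) * hδK
  rcases (add_nonneg (norm_nonneg a) (norm_nonneg d)).eq_or_lt with hR | hR
  · have hd0 : ‖d‖ = 0 := by linarith [norm_nonneg a, norm_nonneg d]
    have ha0 : ‖a‖ = 0 := by linarith [norm_nonneg a, norm_nonneg d]
    rw [norm_eq_zero] at hd0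
    subst hd0
    simp only [add_zero, sub_zero, norm_zero, zero_mul, mul_zero, zero_add] at hcomb' ⊢
    have := mul_le_mul_of_nonneg_left c4 hδ0.le
    linarith
  have c5 := rpow_norm_uniform_convex hp hp2 a d hR
  have final := min_mul_le_of_growth hp hp2 hpq hκ0 hκ1 hδ0 (norm_nonneg d) hR c3
    (sub_nonneg.2 c4) fun hx => by
      simpa [hm] using bellmanPsi_sub_ge hp hp2 hpq hx hs hsm
  have c5' : ‖a‖ ^ p + 4 * κ * ((‖a‖ + ‖d‖) ^ (p - 2) * ‖d‖ ^ 2)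
      ≤ (‖a + d‖ ^ p + ‖a - d‖ ^ p) / 2 := by
    rw [hκ]; linarith
  linarith

/-- Explicit admissible parameters, which depend on the exponent only. -/
theorem isAdmissible_explicit {p q : ℝ} (hp : 1 < p) (hp2 : p ≤ 2) (hpq : 1 / p + 1 / q = 1)
    (𝒜 : Type*) :
    IsAdmissible p q 1 (1 / (2 * convexityConst p))
      (1 / min (p * (p - 1) / 8) (1 / (2 * convexityConst p))) 𝒜 := by
  obtain ⟨hq, he⟩ := conj_exponent hp hp2 hpq
  have hK := convexityConst_ge hp
  set δ := 1 / (2 * convexityConst p) with hδ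
  have hδ0 : 0 < δ := by positivity
  have hδK : δ * (2 * convexityConst p) = 1 := by rw [hδ]; field_simp
  have hδ1 : δ * 3 ≤ 1 := by nlinarith
  set c := min (p * (p - 1) / 8) δ with hc
  have hc0 : 0 < c := lt_min (div_pos (mul_pos (by linarith) (by linarith)) (by norm_num)) hδ0
  refine ⟨zero_le_one, hδ0, by positivity, ?_, ?_, ?_⟩
  · unfold bellmanCandidate
    simp only [bellmanZero_one hp hpq]
    have hψ : ContinuousOn (fun x : EllTwo 𝒜 × ℝ × ℝ × ℝ => bellmanPsi p q ‖x.1‖ x.2.1)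
        (bellmanDomain p q 𝒜) :=
      (continuousOn_bellmanPsi hp hp2 hpq).comp
        (f := fun x : EllTwo 𝒜 × ℝ × ℝ × ℝ => (‖x.1‖, x.2.1)) (by fun_prop)
        fun x hx => ⟨norm_nonneg _, hx.1⟩
    have c1 : Continuous fun x : EllTwo 𝒜 × ℝ × ℝ × ℝ => ‖x.1‖ ^ p :=
      (Real.continuous_rpow_const (by linarith)).comp (by fun_prop)
    have c2 : Continuous fun x : EllTwo 𝒜 × ℝ × ℝ × ℝ => x.2.1 ^ (q / 2) :=
      (Real.continuous_rpow_const (by linarith)).comp (by fun_prop)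
    refine continuousOn_const.mul (ContinuousOn.sub (ContinuousOn.sub (ContinuousOn.sub ?_
      c1.continuousOn) c2.continuousOn) (continuousOn_const.mul hψ))
    fun_prop
  -- Since `3 δ ≤ 1`, the subtracted terms are at most `2(‖x₁‖^p + x₂^(q/2))`, and on `Ω_p` the two
  -- powers are bounded by `x₃` and `x₄`.
  · rintro x ⟨h1, h2, h3, h4, h5⟩ -
    unfold bellmanCandidate
    rw [bellmanZero_one hp hpq]
    refine mul_nonneg (by positivity) ?_
    have h6 : x.2.1 ^ (q / 2) ≤ x.2.2.2 := by
      calc x.2.1 ^ (q / 2) ≤ (x.2.2.2 ^ (2 / q)) ^ (q / 2) :=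
            Real.rpow_le_rpow h1 h5 (by linarith)
        _ = x.2.2.2 := by
          rw [← Real.rpow_mul h3, div_mul_div_comm, mul_comm 2 q, div_self (by positivity),
            Real.rpow_one]
    have h7 := bellmanPsi_le hp hp2 hpq (norm_nonneg x.1) h1
    have h8 : 0 ≤ ‖x.1‖ ^ p := by positivity
    have h9 : 0 ≤ x.2.1 ^ (q / 2) := by positivity
    have := mul_le_mul_of_nonneg_left h7 hδ0.le
    nlinarith
  · rintro ⟨a, s, x₃, x₄⟩ ⟨h1, h2, h3, h4, h5⟩ ⟨a₁, s₁, y₃, y₄⟩ ⟨i1, i2, i3, i4, i5⟩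
      ⟨a₂, s₂, z₃, z₄⟩ ⟨j1, j2, j3, j4, j5⟩ D hD
    simp only [Prod.mk_add_mk, Prod.smul_mk, Prod.mk_sub_mk, Prod.mk.injEq, smul_eq_mul] at hD
    obtain ⟨e1, e2, e3, e4⟩ := hD
    simp only at h1 i1 j1
    unfold bellmanCandidate
    simp only [bellmanZero_one hp hpq]
    set d := (1 / 2 : ℝ) • (a₁ - a₂) with hd
    have ha : a = (1 / 2 : ℝ) • (a₁ + a₂) := (sub_eq_zero.1 e1).symm
    have ha1 : a₁ = a + d := by rw [ha, hd]; module
    have ha2 : a₂ = a - d := by rw [ha, hd]; module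
    have hdn : ‖a₁ - a₂‖ / 2 = ‖d‖ := by
      rw [hd, norm_smul]; norm_num; ring
    have main := bellman_main_inequality hp hp2 hpq hδK a d s s₁ s₂ D h1 i1 j1 (by linarith)
    rw [← hc, ← ha1, ← ha2] at main
    rw [hdn]
    have hC : 1 / c * c = 1 := by field_simp
    have := mul_le_mul_of_nonneg_left main (by positivity : 0 ≤ 1 / c)
    linear_combination this - ‖d‖ * |D| * hC + (1 / c) * (2 * e3 + 2 * e4)

/-! ### Dyadic intervals and the orthonormal Haar system -/

theorem mem_dyadicInterval_iff {n k : ℕ} {x : ℝ} :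
    x ∈ dyadicInterval n k ↔ ⌊x * 2 ^ n⌋ = (k : ℤ) := by
  have h2 : (0 : ℝ) < 2 ^ n := by positivity
  rw [Int.floor_eq_iff, dyadicInterval, mem_Ico, div_le_iff₀ h2, lt_div_iff₀ h2]
  simp

/-- Nesting becomes integer division: the ancestor of index `l` that lies `m - n` generations up has
index `l / 2^(m-n)`. -/
theorem mem_dyadicInterval_iff_of_mem {m l n k : ℕ} {x : ℝ} (hx : x ∈ dyadicInterval m l)
    (h : n ≤ m) : x ∈ dyadicInterval n k ↔ l / 2 ^ (m - n) = k := by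
  rw [mem_dyadicInterval_iff] at hx ⊢
  have e : x * 2 ^ n = x * 2 ^ m / ((2 ^ (m - n) : ℕ) : ℝ) := by
    have : (2 : ℝ) ^ m = 2 ^ n * 2 ^ (m - n) := by rw [← pow_add]; congr 1; omega
    rw [this]; push_cast; field_simp
  rw [e, Int.floor_div_natCast, hx]
  norm_cast

theorem measurableSet_dyadicInterval (n k : ℕ) : MeasurableSet (dyadicInterval n k) :=
  measurableSet_Ico

theorem dyadicInterval_eq_union (n k : ℕ) :
    dyadicInterval n k = dyadicInterval (n + 1) (2 * k) ∪ dyadicInterval (n + 1) (2 * k + 1) := by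
  have h2 : (0 : ℝ) < 2 ^ n := by positivity
  unfold dyadicInterval
  rw [show ((2 * k : ℕ) : ℝ) / 2 ^ (n + 1) = k / 2 ^ n by push_cast; field_simp; ring,
    show (((2 * k + 1 : ℕ) : ℝ) + 1) / 2 ^ (n + 1) = (k + 1) / 2 ^ n by
      push_cast; field_simp; ring,
    show (((2 * k : ℕ) : ℝ) + 1) / 2 ^ (n + 1) = ((2 * k + 1 : ℕ) : ℝ) / 2 ^ (n + 1) by push_cast; rfl,
    Ico_union_Ico_eq_Ico]
  · rw [div_le_div_iff₀ (by positivity) (by positivity)]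
    push_cast; rw [pow_succ]; nlinarith
  · rw [div_le_div_iff₀ (by positivity) (by positivity)]
    push_cast; rw [pow_succ]; nlinarith

theorem disjoint_dyadicInterval {n k l : ℕ} (h : k ≠ l) :
    Disjoint (dyadicInterval n k) (dyadicInterval n l) := by
  refine disjoint_left.2 fun x hx hx' => h ?_
  have := (mem_dyadicInterval_iff_of_mem hx le_rfl).1 hx'
  simpa using this

theorem dyadicInterval_subset {n k : ℕ} (hk : k < 2 ^ n) : dyadicInterval n k ⊆ Icc 0 1 := by
  intro x hx
  refine ⟨le_trans (by positivity) hx.1, hx.2.le.trans ?_⟩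
  rw [div_le_one (by positivity)]
  exact_mod_cast hk

theorem unitMeasure_real_dyadicInterval {n k : ℕ} (hk : k < 2 ^ n) :
    unitMeasure.real (dyadicInterval n k) = 1 / 2 ^ n := by
  rw [measureReal_restrict_apply (measurableSet_dyadicInterval n k),
    inter_eq_left.2 (dyadicInterval_subset hk), dyadicInterval, Real.volume_real_Ico_of_le]
  · ring
  · gcongr; linarith

theorem restrict_dyadicInterval_zero : unitMeasure.restrict (dyadicInterval 0 0) = unitMeasure := by
  rw [Measure.restrict_restrict (measurableSet_dyadicInterval 0 0),
    inter_eq_left.2 (dyadicInterval_subset (by norm_num))]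
  simp only [dyadicInterval, unitMeasure]
  norm_num
  exact Measure.restrict_congr_set Ico_ae_eq_Icc

theorem unitMeasure_dyadicInterval_of_ge {n k : ℕ} (hk : 2 ^ n ≤ k) :
    unitMeasure (dyadicInterval n k) = 0 := by
  rw [Measure.restrict_apply (measurableSet_dyadicInterval n k)]
  refine measure_mono_null (t := {1}) ?_ (by simp)
  rintro x ⟨h1, h2⟩
  refine le_antisymm h2.2 (le_trans ?_ h1.1)
  rw [one_le_div (by positivity)]
  exact_mod_cast hk

instance : IsProbabilityMeasure unitMeasure := ⟨by simp [unitMeasure]⟩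

/-- A Haar function is constant on the dyadic intervals of the later generations. -/
theorem haarFun_of_mem {J : DyadicLabel} {m l : ℕ} (h : J.1 < m) {x : ℝ}
    (hx : x ∈ dyadicInterval m l) :
    haarFun (some J) x = √(2 ^ J.1) * ((if l / 2 ^ (m - (J.1 + 1)) = 2 * J.2 then 1 else 0)
      - (if l / 2 ^ (m - (J.1 + 1)) = 2 * J.2 + 1 then 1 else 0)) := by
  classical
  simp only [haarFun, indicator_apply, mem_dyadicInterval_iff_of_mem hx h]

theorem haarFun_of_notMem {J : DyadicLabel} {x : ℝ} (hx : x ∉ J.toSet) :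
    haarFun (some J) x = 0 := by
  rw [DyadicLabel.toSet, dyadicInterval_eq_union, mem_union, not_or] at hx
  simp [haarFun, hx.1, hx.2]

theorem integrable_haarFun_smul {E : Type*} [NormedAddCommGroup E] [NormedSpace ℝ E]
    {F : ℝ → E} {μ : Measure ℝ} (hF : Integrable F μ) (i : Option DyadicLabel) :
    Integrable (fun x => haarFun i x • F x) μ := by
  obtain ⟨C, hC⟩ := exists_bound_haarFun i
  exact hF.bdd_smul C (measurable_haarFun i).aestronglyMeasurable (Filter.Eventually.of_forall hC)

theorem integral_haarFun_smul {E : Type*} [NormedAddCommGroup E] [NormedSpace ℝ E]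
    {F : ℝ → E} {μ : Measure ℝ} (hF : Integrable F μ) (J : DyadicLabel) :
    ∫ x, haarFun (some J) x • F x ∂μ
      = √(2 ^ J.1) • (∫ x in dyadicInterval (J.1 + 1) (2 * J.2), F x ∂μ
          - ∫ x in dyadicInterval (J.1 + 1) (2 * J.2 + 1), F x ∂μ) := by
  have m := measurableSet_dyadicInterval
  rw [← integral_indicator (m _ _), ← integral_indicator (m _ _), ← integral_sub
    (hF.indicator (m _ _)) (hF.indicator (m _ _)), ← integral_smul]
  congr 1
  funext x
  have e : ∀ s : Set ℝ, s.indicator (fun _ => (1 : ℝ)) x • F x = s.indicator F x := fun s => by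
    by_cases h : x ∈ s <;> simp [h]
  simp only [haarFun, mul_smul, sub_smul, e]

/-- `h_J` has mean zero and vanishes outside `J`, where the other factor is constant. -/
theorem integral_haarFun_mul_haarFun_of_lt {J : DyadicLabel} {i : Option DyadicLabel}
    (h : ∃ c, ∀ x ∈ J.toSet, haarFun i x = c) :
    ∫ x, haarFun (some J) x * haarFun i x ∂unitMeasure = 0 := by
  obtain ⟨c, hc⟩ := h
  have hJ := J.2.2
  have e : ∀ x, haarFun (some J) x * haarFun i x = haarFun (some J) x • c := fun x => by
    by_cases hx : x ∈ J.toSet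
    · rw [hc x hx, smul_eq_mul]
    · simp [haarFun_of_notMem hx]
  simp only [e]
  rw [integral_haarFun_smul (integrable_const c), setIntegral_const, setIntegral_const,
    unitMeasure_real_dyadicInterval, unitMeasure_real_dyadicInterval, sub_self, smul_zero]
  · rw [pow_succ]; omega
  · rw [pow_succ]; omega

theorem integral_haarFun_mul_self (i : Option DyadicLabel) :
    ∫ x, haarFun i x * haarFun i x ∂unitMeasure = 1 := by
  cases i with
  | none => simp [haarFun]
  | some J =>
    have hJ := J.2.2
    obtain ⟨C, hC⟩ := exists_bound_haarFun (some J)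
    have hi : Integrable (haarFun (some J)) unitMeasure :=
      Integrable.of_bound (measurable_haarFun _).aestronglyMeasurable C
        (Filter.Eventually.of_forall hC)
    have := integral_haarFun_smul hi J
    simp only [smul_eq_mul] at this
    rw [this]
    have e1 : ∀ x ∈ dyadicInterval (J.1 + 1) (2 * J.2), haarFun (some J) x = √(2 ^ J.1) := by
      intro x hx
      rw [haarFun_of_mem (Nat.lt_succ_self _) hx]; simp
    have e2 : ∀ x ∈ dyadicInterval (J.1 + 1) (2 * J.2 + 1), haarFun (some J) x = -√(2 ^ J.1) := by
      intro x hx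
      rw [haarFun_of_mem (Nat.lt_succ_self _) hx]; simp
    rw [setIntegral_congr_fun (measurableSet_dyadicInterval _ _) e1,
      setIntegral_congr_fun (measurableSet_dyadicInterval _ _) e2, setIntegral_const,
      setIntegral_const, unitMeasure_real_dyadicInterval, unitMeasure_real_dyadicInterval]
    · have h2 : √((2 : ℝ) ^ J.1) * √(2 ^ J.1) = 2 ^ J.1 := Real.mul_self_sqrt (by positivity)
      simp only [smul_eq_mul]
      rw [show √((2 : ℝ) ^ J.1) * (1 / 2 ^ (J.1 + 1) * √(2 ^ J.1)
        - 1 / 2 ^ (J.1 + 1) * -√(2 ^ J.1)) = (√((2 : ℝ) ^ J.1) * √(2 ^ J.1)) * 2 / 2 ^ (J.1 + 1) by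
        ring, h2, pow_succ]
      field_simp
    · rw [pow_succ]; omega
    · rw [pow_succ]; omega

theorem integral_haarFun_mul_haarFun {i j : Option DyadicLabel} (hij : i ≠ j) :
    ∫ x, haarFun i x * haarFun j x ∂unitMeasure = 0 := by
  have aux : ∀ J K : DyadicLabel, J ≠ K → K.1 ≤ J.1 →
      ∫ x, haarFun (some J) x * haarFun (some K) x ∂unitMeasure = 0 := by
    intro J K hJK hle
    refine integral_haarFun_mul_haarFun_of_lt ?_
    rcases hle.eq_or_lt with h | h
    · obtain ⟨n, k⟩ := J
      obtain ⟨m, l⟩ := K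
      obtain rfl : m = n := h
      refine ⟨0, fun x hx => haarFun_of_notMem fun hx' => hJK ?_⟩
      have := (mem_dyadicInterval_iff_of_mem hx le_rfl).1 hx'
      simp only [Nat.sub_self, pow_zero, Nat.div_one] at this
      rw [Fin.ext this]
    · exact ⟨_, fun x hx => haarFun_of_mem h hx⟩
  match i, j with
  | none, none => exact absurd rfl hij
  | some J, none => exact integral_haarFun_mul_haarFun_of_lt ⟨1, fun x _ => rfl⟩
  | none, some J =>
    simp_rw [mul_comm (haarFun none _)]
    exact integral_haarFun_mul_haarFun_of_lt ⟨1, fun x _ => rfl⟩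
  | some J, some K =>
    have hne : J ≠ K := fun h => hij (h ▸ rfl)
    rcases le_total K.1 J.1 with h | h
    · exact aux J K hne h
    · simp_rw [mul_comm (haarFun (some J) _)]
      exact aux K J hne.symm h

open scoped InnerProductSpace

theorem Lp.integrable_two {E : Type*} [NormedAddCommGroup E] (f : Lp E 2 unitMeasure) :
    Integrable f unitMeasure :=
  (Lp.memLp f).integrable one_le_two

/-- Scalar coefficients are the components of one `ℓ²(𝒜)`-valued Bochner integral, so completeness
can be proved for vector-valued functions at once. -/
theorem inner_vectorHaar {𝒜 : Type*} (i : Option DyadicLabel) (α : 𝒜)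
    (f : Lp (EllTwo 𝒜) 2 unitMeasure) :
    ⟪vectorHaar i α, f⟫_ℝ = (∫ x, haarFun i x • f x ∂unitMeasure : EllTwo 𝒜) α := by
  classical
  have h1 : (∫ x, haarFun i x • f x ∂unitMeasure : EllTwo 𝒜) α
      = ⟪(lp.single 2 α (1 : ℝ) : EllTwo 𝒜), ∫ x, haarFun i x • f x ∂unitMeasure⟫_ℝ := by
    rw [lp.inner_single_left]; simp
  rw [h1, ← integral_inner (integrable_haarFun_smul (Lp.integrable_two f) i), L2.inner_def]
  refine integral_congr_ae ?_
  filter_upwards [(memLp_vectorHaarFun i α).coeFn_toLp] with x hx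
  rw [vectorHaar, hx, vectorHaarFun, real_inner_smul_left, real_inner_smul_right]

theorem inner_vectorHaar_vectorHaar {𝒜 : Type*} [DecidableEq 𝒜] (i j : Option DyadicLabel)
    (α β : 𝒜) :
    ⟪vectorHaar i α, vectorHaar j β⟫_ℝ = if (i, α) = (j, β) then 1 else 0 := by
  classical
  rw [inner_vectorHaar]
  have h : ∫ x, haarFun i x • (vectorHaar j β : ℝ → EllTwo 𝒜) x ∂unitMeasure
      = (∫ x, haarFun i x * haarFun j x ∂unitMeasure) • (lp.single 2 β (1 : ℝ) : EllTwo 𝒜) := by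
    rw [← integral_smul_const]
    refine integral_congr_ae ?_
    filter_upwards [(memLp_vectorHaarFun j β).coeFn_toLp] with x hx
    rw [vectorHaar, hx, vectorHaarFun, smul_smul]
    congr!
  rw [h]
  by_cases hij : i = j
  · subst hij
    rw [integral_haarFun_mul_self, one_smul, lp.coeFn_single]
    by_cases hαβ : α = β
    · subst hαβ; simp
    · simp [hαβ]
  · rw [integral_haarFun_mul_haarFun hij]
    simp [hij]

theorem orthonormal_vectorHaar {𝒜 : Type*} :
    Orthonormal ℝ fun j : Option DyadicLabel × 𝒜 => vectorHaar j.1 j.2 := by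
  classical
  rw [orthonormal_iff_ite]
  rintro ⟨i, α⟩ ⟨j, β⟩
  exact inner_vectorHaar_vectorHaar i j α β

/-! ### Completeness of the Haar system -/

section Completeness

variable {E : Type*} [NormedAddCommGroup E] [NormedSpace ℝ E]

theorem setIntegral_dyadicInterval_eq_add {F : ℝ → E} {μ : Measure ℝ} (hF : Integrable F μ)
    (n k : ℕ) : ∫ x in dyadicInterval n k, F x ∂μ
      = ∫ x in dyadicInterval (n + 1) (2 * k), F x ∂μ
        + ∫ x in dyadicInterval (n + 1) (2 * k + 1), F x ∂μ := by
  rw [dyadicInterval_eq_union n k]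
  exact setIntegral_union (disjoint_dyadicInterval (by omega))
    (measurableSet_dyadicInterval _ _) hF.integrableOn hF.integrableOn

/-- Induction on the generation: the integrals over the two halves have sum zero by induction and
difference zero by the Haar coefficient of the parent. -/
theorem setIntegral_dyadicInterval_eq_zero {F : ℝ → E} (hF : Integrable F unitMeasure)
    (h : ∀ i, ∫ x, haarFun i x • F x ∂unitMeasure = 0) (n k : ℕ) :
    ∫ x in dyadicInterval n k, F x ∂unitMeasure = 0 := by
  rcases le_or_gt (2 ^ n) k with hk | hk
  · rw [Measure.restrict_eq_zero.2 (unitMeasure_dyadicInterval_of_ge hk), integral_zero_measure]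
  induction n generalizing k with
  | zero =>
    obtain rfl : k = 0 := by simpa using hk
    rw [restrict_dyadicInterval_zero]
    simpa [haarFun] using h none
  | succ n ih =>
    have hk' : k / 2 < 2 ^ n := by rw [pow_succ] at hk; omega
    have h1 := ih (k / 2) hk'
    have h2 := h (some ⟨n, ⟨k / 2, hk'⟩⟩)
    rw [integral_haarFun_smul hF, smul_eq_zero, or_iff_right (by positivity), sub_eq_zero] at h2
    simp only at h2
    rw [setIntegral_dyadicInterval_eq_add hF, ← h2, ← two_smul ℝ, smul_eq_zero,
      or_iff_right (by norm_num)] at h1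
    rcases Nat.even_or_odd' k with ⟨l, rfl | rfl⟩
    · rwa [show 2 * l / 2 = l by omega] at h1
    · rw [h2, show (2 * l + 1) / 2 = l by omega] at h1
      exact h1

-- The primitive of `F` vanishes at dyadic rationals, hence everywhere on the half-line by
-- continuity. So `F` integrates to zero over all half-lines, and then over all Borel sets because
-- half-lines form a generating π-system.
open Filter Topology in
theorem ae_eq_zero_of_integral_haarFun [CompleteSpace E] {F : ℝ → E}
    (hF : Integrable F unitMeasure) (h : ∀ i, ∫ x, haarFun i x • F x ∂unitMeasure = 0) :
    F =ᵐ[unitMeasure] 0 := by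
  have hD := setIntegral_dyadicInterval_eq_zero hF h
  have hint : ∀ a b : ℝ, IntervalIntegrable F unitMeasure a b := fun a b =>
    hF.intervalIntegrable
  have hprim : ∀ n k : ℕ, ∫ x in (0 : ℝ)..(k / 2 ^ n), F x ∂unitMeasure = 0 := by
    intro n k
    induction k with
    | zero => simp
    | succ k ih =>
      rw [← intervalIntegral.integral_add_adjacent_intervals (hint 0 (k / 2 ^ n)) (hint _ _), ih,
        zero_add, intervalIntegral.integral_of_le (by gcongr; simp),
        ← integral_Ico_eq_integral_Ioc]
      simpa [dyadicInterval] using hD n k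
  have hprim' : ∀ b : ℝ, 0 ≤ b → ∫ x in (0 : ℝ)..b, F x ∂unitMeasure = 0 := by
    intro b hb
    have hc := intervalIntegral.continuous_primitive hint 0
    have ht : Tendsto (fun n : ℕ => (⌊b * 2 ^ n⌋₊ : ℝ) / 2 ^ n) atTop (𝓝 b) :=
      (tendsto_nat_floor_mul_div_atTop hb).comp (tendsto_pow_atTop_atTop_of_one_lt one_lt_two)
    refine tendsto_nhds_unique ((hc.tendsto b).comp ht) ?_
    simp only [Function.comp_def, hprim]
    exact tendsto_const_nhds
  have hneg : unitMeasure (Iic (0 : ℝ)) = 0 := by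
    rw [Measure.restrict_apply measurableSet_Iic]
    refine measure_mono_null (t := {0}) ?_ (by simp)
    rintro x ⟨h1, h2⟩
    exact le_antisymm h1 h2.1
  have hIic : ∀ b : ℝ, ∫ x in Iic b, F x ∂unitMeasure = 0 := by
    intro b
    rcases le_total b 0 with hb | hb
    · rw [Measure.restrict_eq_zero.2 (measure_mono_null (Iic_subset_Iic.2 hb) hneg),
        integral_zero_measure]
    · have h1 := hprim' b hb
      rw [intervalIntegral.integral_of_le hb] at h1
      rw [← Iic_union_Ioc_eq_Iic hb, setIntegral_union (Iic_disjoint_Ioc le_rfl) measurableSet_Ioc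
        hF.integrableOn hF.integrableOn, h1, Measure.restrict_eq_zero.2 hneg,
        integral_zero_measure, add_zero]
  have htot : ∫ x, F x ∂unitMeasure = 0 := by
    rw [← hD 0 0, restrict_dyadicInterval_zero]
  refine hF.ae_eq_zero_of_forall_setIntegral_eq_zero fun s hs _ => ?_
  induction s, hs using MeasurableSpace.induction_on_inter (borel_eq_generateFrom_Iic ℝ)
    isPiSystem_Iic with
  | empty => simp
  | basic t ht =>
    obtain ⟨b, rfl⟩ := ht
    exact hIic b
  | compl t ht ih =>
    rw [setIntegral_compl ht hF, htot, ih (measure_lt_top _ _), sub_zero]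
  | iUnion f hd hm ih =>
    rw [integral_iUnion hm hd hF.integrableOn]
    simp [ih _ (measure_lt_top _ _)]

end Completeness

theorem topologicalClosure_haarSpan (𝒜 : Type*) : (haarSpan 𝒜).topologicalClosure = ⊤ := by
  rw [Submodule.topologicalClosure_eq_top_iff, Submodule.eq_bot_iff]
  intro f hf
  rw [Submodule.mem_orthogonal] at hf
  have h : ∀ i, ∫ x, haarFun i x • f x ∂unitMeasure = 0 := fun i => by
    ext α
    rw [← inner_vectorHaar]
    exact hf _ (haarElt i α).2
  exact Lp.ext ((ae_eq_zero_of_integral_haarFun (Lp.integrable_two f) h).trans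
    (Lp.coeFn_zero _ _ _).symm)

/-! ### The bounded extension to `L²` -/

theorem norm_sq_eq_integral {f : ℝ → ℝ} {μ : Measure ℝ} (hf : MemLp f 2 μ) :
    ‖hf.toLp f‖ ^ 2 = ∫ x, f x ^ 2 ∂μ := by
  rw [← real_inner_self_eq_norm_sq, L2.inner_def]
  refine integral_congr_ae ?_
  filter_upwards [hf.coeFn_toLp] with x hx
  rw [hx]; simp [sq]

open Filter Topology in
/-- A converse of Hölder's inequality: a function that defines a bounded functional on `L²` is
square integrable. -/
theorem eLpNorm_two_le_of_forall_integral_mul_le {φ : ℝ → ℝ} {μ : Measure ℝ} [IsFiniteMeasure μ]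
    (hφ : AEStronglyMeasurable φ μ) {M : ℝ} (hM : 0 ≤ M)
    (h : ∀ g : Lp ℝ 2 μ, ∫ x, g x * φ x ∂μ ≤ M * ‖g‖) :
    eLpNorm φ 2 μ ≤ ENNReal.ofReal M := by
  wlog hm : StronglyMeasurable φ generalizing φ
  · rw [eLpNorm_congr_ae hφ.ae_eq_mk]
    refine this hφ.stronglyMeasurable_mk.aestronglyMeasurable (fun g => ?_)
      hφ.stronglyMeasurable_mk
    refine le_trans (le_of_eq (integral_congr_ae ?_)) (h g)
    filter_upwards [hφ.ae_eq_mk] with x hx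
    rw [hx]
  -- Testing against the truncation itself gives `‖G n‖² ≤ M ‖G n‖`; Fatou's lemma then passes the
  -- bound to `φ`.
  set G : ℕ → ℝ → ℝ := fun n => {x | ‖φ x‖ ≤ n}.indicator φ with hG
  have hmeas : ∀ n : ℕ, MeasurableSet {x | ‖φ x‖ ≤ n} := fun n =>
    hm.norm.measurable measurableSet_Iic
  have hin : ∀ (n : ℕ) x, ‖φ x‖ ≤ n → G n x = φ x := fun n x hx =>
    indicator_of_mem (s := {x | ‖φ x‖ ≤ n}) hx φ
  have hout : ∀ (n : ℕ) x, ¬ ‖φ x‖ ≤ n → G n x = 0 := fun n x hx =>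
    indicator_of_notMem (s := {x | ‖φ x‖ ≤ n}) hx φ
  have hmem : ∀ n, MemLp (G n) 2 μ := fun n => by
    refine MemLp.of_bound (hφ.indicator (hmeas n)) n (Eventually.of_forall fun x => ?_)
    by_cases hx : ‖φ x‖ ≤ n
    · rwa [hin n x hx]
    · rw [hout n x hx]; simp
  have hle : ∀ n, eLpNorm (G n) 2 μ ≤ ENNReal.ofReal M := fun n => by
    have h1 := h ((hmem n).toLp)
    have h2 : ∫ x, ((hmem n).toLp : Lp ℝ 2 μ) x * φ x ∂μ = ‖(hmem n).toLp‖ ^ 2 := by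
      rw [norm_sq_eq_integral]
      refine integral_congr_ae ?_
      filter_upwards [(hmem n).coeFn_toLp] with x hx
      rw [hx]
      by_cases hx : ‖φ x‖ ≤ n
      · rw [hin n x hx, sq]
      · rw [hout n x hx]; simp
    rw [h2, sq] at h1
    have h3 : ‖(hmem n).toLp‖ ≤ M := by
      rcases (norm_nonneg (hmem n).toLp).eq_or_lt with h0 | h0
      · rwa [← h0]
      · exact le_of_mul_le_mul_right h1 h0
    rw [← Lp.enorm_toLp (hmem n), ← ofReal_norm]
    exact ENNReal.ofReal_le_ofReal h3
  refine (Lp.eLpNorm_lim_le_liminf_eLpNorm (fun n => (hmem n).1) φ ?_).trans ?_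
  · refine Eventually.of_forall fun x => ?_
    refine tendsto_const_nhds.congr' ?_
    obtain ⟨N, hN⟩ := exists_nat_ge ‖φ x‖
    filter_upwards [eventually_ge_atTop N] with n hn
    exact (hin n x (hN.trans (by exact_mod_cast hn))).symm
  · exact liminf_le_of_le (by isBoundedDefault) fun b hb => by
      obtain ⟨n, hn⟩ := hb.exists
      exact hn.trans (hle n)

theorem AEEqFun.coeFn_finset_sum_smul {ι : Type*} {μ : Measure ℝ} (s : Finset ι) (c : ι → ℝ)
    (φ : ι → ℝ →ₘ[μ] ℝ) : ⇑(∑ j ∈ s, c j • φ j) =ᵐ[μ] fun x => ∑ j ∈ s, c j * φ j x := by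
  classical
  induction s using Finset.induction_on with
  | empty => simpa [Pi.zero_def] using AEEqFun.coeFn_zero (μ := μ) (β := ℝ)
  | insert a s ha ih =>
    rw [Finset.sum_insert ha]
    filter_upwards [AEEqFun.coeFn_add (c a • φ a) (∑ j ∈ s, c j • φ j), ih,
      AEEqFun.coeFn_smul (c a) (φ a)] with x h1 h2 h3
    rw [h1, Pi.add_apply, h2, h3, Finset.sum_insert ha, Pi.smul_apply, smul_eq_mul]

section ClassG

variable {𝒜 : Type*} {T : haarSpan 𝒜 →ₗ[ℝ] (ℝ →ₘ[unitMeasure] ℝ)}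

/-- The pairing of a square integrable function with the image of a vector Haar function. -/
noncomputable def haarPairing (T : haarSpan 𝒜 →ₗ[ℝ] (ℝ →ₘ[unitMeasure] ℝ))
    (g : Lp ℝ 2 unitMeasure) (i : Option DyadicLabel) (α : 𝒜) : ℝ :=
  ∫ x, g x * T (haarElt i α) x ∂unitMeasure

theorem haarSpan_exists_sum (f : haarSpan 𝒜) : ∃ c : Option DyadicLabel × 𝒜 →₀ ℝ,
    f = ∑ j ∈ c.support, c j • haarElt j.1 j.2 := by
  obtain ⟨c, hc⟩ := Finsupp.mem_span_range_iff_exists_finsupp.1 f.2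
  refine ⟨c, Subtype.ext ?_⟩
  rw [← hc, Finsupp.sum]
  simp [haarElt]

theorem integral_mul_map_sum (hT : IsClassG T) (g : Lp ℝ 2 unitMeasure)
    (s : Finset (Option DyadicLabel × 𝒜)) (c : Option DyadicLabel × 𝒜 → ℝ) :
    ∫ x, g x * T (∑ j ∈ s, c j • haarElt j.1 j.2) x ∂unitMeasure
      = ∑ j ∈ s, c j * haarPairing T g j.1 j.2 := by
  have h : ∀ᵐ x ∂unitMeasure, g x * T (∑ j ∈ s, c j • haarElt j.1 j.2) x
      = ∑ j ∈ s, c j * (g x * T (haarElt j.1 j.2) x) := by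
    rw [map_sum]
    simp_rw [map_smul]
    filter_upwards [AEEqFun.coeFn_finset_sum_smul s c fun j => T (haarElt j.1 j.2)] with x hx
    rw [hx, Finset.mul_sum]
    exact Finset.sum_congr rfl fun j _ => by ring
  rw [integral_congr_ae h, integral_finsetSum _ fun j _ => (hT.integrable g j.1 j.2).const_mul _]
  exact Finset.sum_congr rfl fun j _ => integral_const_mul _ _

/-- Cauchy-Schwarz on Haar coefficients: those of `f` have `ℓ²` norm `‖f‖` by orthonormality, and
the pairings of `g` have norm at most `‖g‖` by Parseval. -/
theorem integral_mul_map_le (hT : IsClassG T) (g : Lp ℝ 2 unitMeasure) (f : haarSpan 𝒜) :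
    ∫ x, g x * T f x ∂unitMeasure ≤ ‖f‖ * ‖g‖ := by
  obtain ⟨c, hc⟩ := haarSpan_exists_sum f
  have hf : ‖f‖ ^ 2 = ∑ j ∈ c.support, c j ^ 2 := by
    have h1 : (f : Lp (EllTwo 𝒜) 2 unitMeasure)
        = ∑ j ∈ c.support, c j • vectorHaar j.1 j.2 := by
      conv_lhs => rw [hc]
      simp [haarElt]
    rw [show ‖f‖ = ‖(f : Lp (EllTwo 𝒜) 2 unitMeasure)‖ from rfl,
      ← real_inner_self_eq_norm_sq, h1,
      orthonormal_vectorHaar.inner_sum c c c.support]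
    exact Finset.sum_congr rfl fun j _ => by simp [sq]
  conv_lhs => rw [hc]
  rw [integral_mul_map_sum hT]
  refine (Real.sum_mul_le_sqrt_mul_sqrt _ _ _).trans ?_
  rw [← hf, Real.sqrt_sq (norm_nonneg f)]
  refine mul_le_mul_of_nonneg_left ?_ (norm_nonneg f)
  rw [Real.sqrt_le_left (norm_nonneg g)]
  exact sum_le_hasSum _ (fun _ _ => sq_nonneg _) (hT.parseval g)

theorem eLpNorm_map_le (hT : IsClassG T) (f : haarSpan 𝒜) :
    eLpNorm (T f) 2 unitMeasure ≤ ENNReal.ofReal ‖f‖ :=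
  eLpNorm_two_le_of_forall_integral_mul_le (T f).stronglyMeasurable.aestronglyMeasurable
    (norm_nonneg f) fun g => integral_mul_map_le hT g f

/-- An operator of the class `𝒢`, as a map into `L²`. -/
noncomputable def IsClassG.toLp (hT : IsClassG T) : haarSpan 𝒜 →ₗ[ℝ] Lp ℝ 2 unitMeasure where
  toFun f := ⟨T f, Lp.mem_Lp_iff_eLpNorm_lt_top.2
    ((eLpNorm_map_le hT f).trans_lt ENNReal.ofReal_lt_top)⟩
  map_add' f g := Subtype.ext (map_add T f g)
  map_smul' c f := Subtype.ext (map_smul T c f)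

theorem IsClassG.norm_toLp_le (hT : IsClassG T) (f : haarSpan 𝒜) : ‖hT.toLp f‖ ≤ ‖f‖ := by
  rw [Lp.norm_def]
  exact ENNReal.toReal_le_of_le_ofReal (norm_nonneg f) (eLpNorm_map_le hT f)

theorem denseRange_haarSpan_subtype : DenseRange (haarSpan 𝒜).subtype := by
  rw [DenseRange, Submodule.coe_subtype, Subtype.range_coe]
  exact Submodule.dense_iff_topologicalClosure_eq_top.2 (topologicalClosure_haarSpan 𝒜)

theorem IsClassG.existsUnique_extension (hT : IsClassG T) :
    ∃! S : Lp (EllTwo 𝒜) 2 unitMeasure →L[ℝ] Lp ℝ 2 unitMeasure, IsBoundedExtension T S := by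
  refine ⟨hT.toLp.extendOfNorm (haarSpan 𝒜).subtype, fun f => ?_, fun S hS => ?_⟩
  · have := hT.toLp.extendOfNorm_eq (e := (haarSpan 𝒜).subtype) denseRange_haarSpan_subtype
      ⟨1, fun f => by simpa using hT.norm_toLp_le f⟩ f
    rw [Submodule.subtype_apply] at this
    rw [this]
    rfl
  · refine (LinearMap.extendOfNorm_unique denseRange_haarSpan_subtype 1
      (fun f => by simpa using hT.norm_toLp_le f) S ?_).symm
    ext1 f
    exact Subtype.ext (hS f)

end ClassG

/-! ### Vector coefficients and the localized Bessel inequality -/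

section Coefficients

variable {𝒜 : Type*} {T : haarSpan 𝒜 →ₗ[ℝ] (ℝ →ₘ[unitMeasure] ℝ)}

/-- The sequence of the pairings `(g, T h_i^α)`, `α ∈ 𝒜`, as an element of `ℓ²(𝒜)`. -/
noncomputable def IsClassG.pairingVec (hT : IsClassG T) (g : Lp ℝ 2 unitMeasure)
    (i : Option DyadicLabel) : EllTwo 𝒜 :=
  ⟨haarPairing T g i, by
    refine memℓp_gen ?_
    have := (hT.parseval g).summable.prod_factor i
    simpa [haarPairing] using this⟩

theorem IsClassG.pairingVec_apply (hT : IsClassG T) (g : Lp ℝ 2 unitMeasure)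
    (i : Option DyadicLabel) (α : 𝒜) : hT.pairingVec g i α = haarPairing T g i α := rfl

theorem IsClassG.hasSum_norm_pairingVec (hT : IsClassG T) (g : Lp ℝ 2 unitMeasure) :
    HasSum (fun i => ‖hT.pairingVec g i‖ ^ 2) (‖g‖ ^ 2) := by
  refine (hT.parseval g).prod_fiberwise fun i => ?_
  have := lp.hasSum_inner (𝕜 := ℝ) (hT.pairingVec g i) (hT.pairingVec g i)
  rw [real_inner_self_eq_norm_sq] at this
  convert! this using 2 with α
  rw [real_inner_self_eq_norm_sq, Real.norm_eq_abs, sq_abs]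
  rfl

/-- The label `i` belongs to a dyadic interval contained in the interval labelled by `(n, k)`. -/
def IsDyadicDescendant (n k : ℕ) : Option DyadicLabel → Prop
  | none => False
  | some J => n ≤ J.1 ∧ (J.2 : ℕ) / 2 ^ (J.1 - n) = k

theorem IsDyadicDescendant.subset {n k : ℕ} {J : DyadicLabel}
    (h : IsDyadicDescendant n k (some J)) : J.toSet ⊆ dyadicInterval n k := fun _ hx =>
  (mem_dyadicInterval_iff_of_mem hx h.1).2 h.2

open Classical in
/-- The total mass `∑ ‖β_I‖²` over the labels `I` of subintervals of the interval `(n, k)`. -/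
noncomputable def IsClassG.descendantSum (hT : IsClassG T) (g : Lp ℝ 2 unitMeasure)
    (n k : ℕ) : ℝ :=
  ∑' i, if IsDyadicDescendant n k i then ‖hT.pairingVec g i‖ ^ 2 else 0

open Classical in
theorem IsClassG.summable_descendant (hT : IsClassG T) (g : Lp ℝ 2 unitMeasure)
    (P : Option DyadicLabel → Prop) :
    Summable fun i => if P i then ‖hT.pairingVec g i‖ ^ 2 else 0 :=
  (hT.hasSum_norm_pairingVec g).summable.of_nonneg_of_le
    (fun i => by split_ifs <;> positivity)
    (fun i => by split_ifs; exacts [le_rfl, sq_nonneg _])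

-- The descendants of an interval are the interval itself and the descendants of its two halves,
-- disjointly.
open Classical in
theorem IsClassG.descendantSum_eq (hT : IsClassG T) (g : Lp ℝ 2 unitMeasure)
    (n : ℕ) (k : Fin (2 ^ n)) :
    hT.descendantSum g n k = ‖hT.pairingVec g (some ⟨n, k⟩)‖ ^ 2
      + hT.descendantSum g (n + 1) (2 * k) + hT.descendantSum g (n + 1) (2 * k + 1) := by
  have h0 : ‖hT.pairingVec g (some ⟨n, k⟩)‖ ^ 2
      = ∑' i, if i = some ⟨n, k⟩ then ‖hT.pairingVec g i‖ ^ 2 else 0 := by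
    rw [tsum_ite_eq]
  rw [h0]
  unfold IsClassG.descendantSum
  have s0 : Summable fun i => if i = some ⟨n, k⟩ then ‖hT.pairingVec g i‖ ^ 2 else 0 := by
    convert! hT.summable_descendant g (· = some ⟨n, k⟩)
  have s1 := hT.summable_descendant g (IsDyadicDescendant (n + 1) (2 * k))
  have s2 := hT.summable_descendant g (IsDyadicDescendant (n + 1) (2 * k + 1))
  rw [← s0.tsum_add s1, ← (s0.add s1).tsum_add s2]
  congr 1
  funext i
  match i with
  | none => simp [IsDyadicDescendant]
  | some ⟨m, l⟩ =>
    rcases lt_trichotomy m n with h | rfl | h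
    · have h1 : (some ⟨m, l⟩ : Option DyadicLabel) ≠ some ⟨n, k⟩ := by
        intro he; simp only [Option.some.injEq, Sigma.mk.injEq] at he; omega
      rw [if_neg h1, if_neg fun hd => absurd hd.1 (by simp; omega),
        if_neg fun hd => absurd hd.1 (by simp; omega),
        if_neg fun hd => absurd hd.1 (by simp; omega)]
      simp
    · rw [if_neg (fun hd => absurd hd.1 (by simp) : ¬ IsDyadicDescendant (m + 1) (2 * k) (some ⟨m, l⟩)),
        if_neg (fun hd => absurd hd.1 (by simp) : ¬ IsDyadicDescendant (m + 1) (2 * k + 1) (some ⟨m, l⟩))]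
      simp [IsDyadicDescendant, Fin.ext_iff]
    · have h1 : (some ⟨m, l⟩ : Option DyadicLabel) ≠ some ⟨n, k⟩ := by
        intro he; simp only [Option.some.injEq, Sigma.mk.injEq] at he; omega
      have e : (l : ℕ) / 2 ^ (m - n) = (l : ℕ) / 2 ^ (m - (n + 1)) / 2 := by
        rw [Nat.div_div_eq_div_mul, ← pow_succ]
        congr 2; omega
      simp only [IsDyadicDescendant, h.le, show n + 1 ≤ m from h, true_and, e, if_neg h1]
      generalize (l : ℕ) / 2 ^ (m - (n + 1)) = a
      by_cases h2 : a = 2 * k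
      · rw [if_pos h2, if_pos (by omega), if_neg (by omega)]; simp
      · by_cases h3 : a = 2 * k + 1
        · rw [if_neg h2, if_pos h3, if_pos (by omega)]; simp
        · rw [if_neg h2, if_neg h3, if_neg (by omega)]; simp

/-- Bessel's inequality on a dyadic interval. -/
theorem IsClassG.descendantSum_le (hT : IsClassG T) (g : Lp ℝ 2 unitMeasure) (n k : ℕ) :
    hT.descendantSum g n k ≤ ∫ x in dyadicInterval n k, g x ^ 2 ∂unitMeasure := by
  classical
  have hm := measurableSet_dyadicInterval n k
  have hg : MemLp ((dyadicInterval n k).indicator g) 2 unitMeasure := (Lp.memLp g).indicator hm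
  have h1 : ∫ x in dyadicInterval n k, g x ^ 2 ∂unitMeasure = ‖hg.toLp‖ ^ 2 := by
    rw [norm_sq_eq_integral, ← integral_indicator hm]
    congr 1
    funext x
    by_cases hx : x ∈ dyadicInterval n k <;> simp [hx]
  -- The support condition enters here: pairings with descendants do not change when `g` is cut off
  -- to the interval. Parseval for the cut-off function then yields the local bound.
  have h2 : ∀ i, IsDyadicDescendant n k i →
      hT.pairingVec g i = hT.pairingVec hg.toLp i := by
    rintro (_ | J) hi
    · exact hi.elim
    ext α
    simp only [IsClassG.pairingVec_apply, haarPairing]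
    refine integral_congr_ae ?_
    filter_upwards [hT.support J α, hg.coeFn_toLp] with x hx hx'
    rw [hx']
    by_cases hxJ : x ∈ J.toSet
    · rw [indicator_of_mem (hi.subset hxJ)]
    · rw [hx hxJ]; simp
  rw [h1, ← (hT.hasSum_norm_pairingVec hg.toLp).tsum_eq]
  refine (hT.summable_descendant g _).tsum_le_tsum (fun i => ?_)
    (hT.hasSum_norm_pairingVec hg.toLp).summable
  split_ifs with h
  · rw [h2 i h]
  · positivity

end Coefficients

/-- The labels of the Haar functions of the generations below `N`. -/
def haarLabels (N : ℕ) : Finset (Option DyadicLabel) :=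
  Finset.insertNone ((Finset.range N).sigma fun _ => Finset.univ)

section Span

variable {𝒜 : Type*} {T : haarSpan 𝒜 →ₗ[ℝ] (ℝ →ₘ[unitMeasure] ℝ)}

/-- The vector Haar coefficient of a function. -/
noncomputable def haarCoeff (f : ℝ → EllTwo 𝒜) (i : Option DyadicLabel) : EllTwo 𝒜 :=
  ∫ x, haarFun i x • f x ∂unitMeasure

/-- One `N` exceeds all generations occurring in `f`. It truncates the bilinear form to a finite sum
and also makes `f` constant on the intervals where the Bellman induction stops. -/
theorem integral_mul_map_eq_sum (hT : IsClassG T) (f : haarSpan 𝒜) :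
    ∃ N : ℕ, (∀ g : Lp ℝ 2 unitMeasure, ∫ x, g x * T f x ∂unitMeasure
      = ∑ i ∈ haarLabels N, ⟪haarCoeff (f : Lp (EllTwo 𝒜) 2 unitMeasure) i,
          hT.pairingVec g i⟫_ℝ) ∧
      ∀ k : ℕ, ∃ w : EllTwo 𝒜, ∀ᵐ x ∂unitMeasure, x ∈ dyadicInterval N k →
        (f : Lp (EllTwo 𝒜) 2 unitMeasure) x = w := by
  classical
  obtain ⟨c, hc⟩ := haarSpan_exists_sum f
  have hfs : (f : Lp (EllTwo 𝒜) 2 unitMeasure) = ∑ j ∈ c.support, c j • vectorHaar j.1 j.2 := by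
    conv_lhs => rw [hc]
    simp [haarElt]
  obtain ⟨N, hN⟩ : ∃ N : ℕ, ∀ j ∈ c.support, ∀ J : DyadicLabel, j.1 = some J → J.1 < N := by
    refine ⟨c.support.sup (fun j => j.1.elim 0 fun J => J.1 + 1), fun j hj J hJ => ?_⟩
    have := Finset.le_sup (f := fun j : Option DyadicLabel × 𝒜 => j.1.elim 0 fun J => J.1 + 1) hj
    simp only [hJ, Option.elim_some] at this
    omega
  refine ⟨N, fun g => ?_, fun k => ?_⟩
  · have hV : ∀ i, haarCoeff (f : Lp (EllTwo 𝒜) 2 unitMeasure) i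
        = ∑ j ∈ c.support, (if j.1 = i then c j else 0) • (lp.single 2 j.2 (1 : ℝ) : EllTwo 𝒜) := by
      intro i
      ext α
      rw [haarCoeff, ← inner_vectorHaar, hfs, inner_sum, lp.coeFn_sum, Finset.sum_apply]
      refine Finset.sum_congr rfl fun j _ => ?_
      rw [inner_smul_right, inner_vectorHaar_vectorHaar, lp.coeFn_smul, Pi.smul_apply,
        lp.coeFn_single]
      by_cases h1 : j.1 = i
      · by_cases h2 : j.2 = α
        · subst h1 h2; simp
        · have : (i, α) ≠ (j.1, j.2) := fun h => h2 (Prod.mk.inj h).2.symm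
          rw [if_neg this, Pi.single_eq_of_ne (Ne.symm h2)]; simp
      · have : (i, α) ≠ (j.1, j.2) := fun h => h1 (Prod.mk.inj h).1.symm
        rw [if_neg this, if_neg h1]; simp
    have hin : ∀ i, ⟪haarCoeff (f : Lp (EllTwo 𝒜) 2 unitMeasure) i, hT.pairingVec g i⟫_ℝ
        = ∑ j ∈ c.support, if j.1 = i then c j * haarPairing T g j.1 j.2 else 0 := by
      intro i
      rw [hV, sum_inner]
      refine Finset.sum_congr rfl fun j _ => ?_
      rw [real_inner_smul_left, lp.inner_single_left, IsClassG.pairingVec_apply]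
      by_cases h1 : j.1 = i
      · subst h1; simp
      · simp [h1]
    conv_lhs => rw [hc]
    rw [integral_mul_map_sum hT, Finset.sum_congr rfl fun i _ => hin i, Finset.sum_comm]
    refine Finset.sum_congr rfl fun j hj => ?_
    rw [Finset.sum_ite_eq, if_pos]
    unfold haarLabels
    rcases hj1 : j.1 with _ | J
    · simp
    · simpa using hN j hj J hj1
  · have hF : ∀ s : Finset (Option DyadicLabel × 𝒜),
        (∀ j ∈ s, ∀ J : DyadicLabel, j.1 = some J → J.1 < N) →
        ∃ w : EllTwo 𝒜, ∀ᵐ x ∂unitMeasure, x ∈ dyadicInterval N k →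
          (∑ j ∈ s, c j • vectorHaar j.1 j.2 : Lp (EllTwo 𝒜) 2 unitMeasure) x = w := by
      intro s
      induction s using Finset.induction_on with
      | empty =>
        intro _
        exact ⟨0, Filter.Eventually.of_forall fun x _ => by simp⟩
      | insert a s ha ih =>
        intro hs
        obtain ⟨w, hw⟩ := ih fun j hj => hs j (Finset.mem_insert_of_mem hj)
        obtain ⟨r, hr⟩ : ∃ r : ℝ, ∀ x ∈ dyadicInterval N k, haarFun a.1 x = r := by
          rcases ha1 : a.1 with _ | J
          · exact ⟨1, fun x _ => rfl⟩
          · exact ⟨_, fun x hx => haarFun_of_mem (hs a (Finset.mem_insert_self _ _) J ha1) hx⟩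
        refine ⟨c a • (r • (lp.single 2 a.2 (1 : ℝ) : EllTwo 𝒜)) + w, ?_⟩
        rw [Finset.sum_insert ha]
        filter_upwards [hw, Lp.coeFn_add (c a • vectorHaar a.1 a.2)
          (∑ j ∈ s, c j • vectorHaar j.1 j.2), Lp.coeFn_smul (c a) (vectorHaar a.1 a.2),
          (memLp_vectorHaarFun a.1 a.2).coeFn_toLp] with x h1 h2 h3 h4 hx
        rw [h2, Pi.add_apply, h1 hx, h3, Pi.smul_apply, vectorHaar, h4, vectorHaarFun, hr x hx]
    rw [hfs]
    exact hF _ hN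

end Span

/-! ### The Bellman induction -/

/-- Jensen's inequality for powers on a dyadic interval. -/
theorem rpow_mul_setIntegral_le {r : ℝ} (hr : 1 ≤ r) {n k : ℕ} (hk : k < 2 ^ n) {φ : ℝ → ℝ}
    (h0 : ∀ x, 0 ≤ φ x) (h1 : Integrable φ unitMeasure)
    (h2 : Integrable (fun x => φ x ^ r) unitMeasure) :
    (2 ^ n * ∫ x in dyadicInterval n k, φ x ∂unitMeasure) ^ r
      ≤ 2 ^ n * ∫ x in dyadicInterval n k, φ x ^ r ∂unitMeasure := by
  have hm := unitMeasure_real_dyadicInterval hk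
  have hne : unitMeasure (dyadicInterval n k) ≠ 0 := by
    intro h
    rw [measureReal_def, h] at hm
    simp at hm
    exact absurd hm.symm (by positivity)
  have key := (convexOn_rpow hr).map_set_average_le
    ((Real.continuous_rpow_const (by linarith : 0 ≤ r)).continuousOn) isClosed_Ici hne
    (measure_ne_top _ _) (f := φ) (Filter.Eventually.of_forall fun x => h0 x)
    h1.integrableOn h2.integrableOn
  rw [setAverage_eq, setAverage_eq, hm] at key
  simpa using key

theorem sum_range_two_mul {M : Type*} [AddCommMonoid M] (a : ℕ → M) (m : ℕ) :
    ∑ k ∈ Finset.range (2 * m), a k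
      = ∑ k ∈ Finset.range m, (a (2 * k) + a (2 * k + 1)) := by
  induction m with
  | zero => simp
  | succ m ih =>
    rw [show 2 * (m + 1) = 2 * m + 1 + 1 by ring, Finset.sum_range_succ, Finset.sum_range_succ,
      Finset.sum_range_succ, ih, add_assoc]

section Bellman

variable {𝒜 : Type*} {T : haarSpan 𝒜 →ₗ[ℝ] (ℝ →ₘ[unitMeasure] ℝ)}

/-- The Bellman point of the pair `(f, g)` on the dyadic interval `(n, k)`. -/
noncomputable def bellmanPoint (p q : ℝ) (hT : IsClassG T) (f : Lp (EllTwo 𝒜) 2 unitMeasure)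
    (g : Lp ℝ 2 unitMeasure) (n k : ℕ) : EllTwo 𝒜 × ℝ × ℝ × ℝ :=
  ((2 ^ n : ℝ) • ∫ x in dyadicInterval n k, f x ∂unitMeasure,
    2 ^ n * (∫ x in dyadicInterval n k, g x ^ 2 ∂unitMeasure - hT.descendantSum g n k),
    2 ^ n * ∫ x in dyadicInterval n k, ‖f x‖ ^ p ∂unitMeasure,
    2 ^ n * ∫ x in dyadicInterval n k, |g x| ^ q ∂unitMeasure)

theorem integrable_rpow_norm {E : Type*} [NormedAddCommGroup E] {p : ℝ} (hp : 1 < p) (hp2 : p ≤ 2)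
    (f : Lp E 2 unitMeasure) : Integrable (fun x => ‖f x‖ ^ p) unitMeasure := by
  have h : MemLp f (ENNReal.ofReal p) unitMeasure := by
    refine (Lp.memLp f).mono_exponent ?_
    rw [← ENNReal.ofReal_ofNat]
    exact ENNReal.ofReal_le_ofReal hp2
  have := h.integrable_norm_rpow (by simp; linarith) ENNReal.ofReal_ne_top
  rwa [ENNReal.toReal_ofReal (by linarith)] at this

/-- Nonnegativity of the second coordinate is the local Bessel inequality; the two power constraints
are Jensen with exponents `p` and `q/2`. -/
theorem bellmanPoint_mem {p q : ℝ} (hp : 1 < p) (hp2 : p ≤ 2) (hpq : 1 / p + 1 / q = 1)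
    (hT : IsClassG T) (f : Lp (EllTwo 𝒜) 2 unitMeasure) (g : Lp ℝ 2 unitMeasure)
    (hg : Integrable (fun x => |g x| ^ q) unitMeasure) {n k : ℕ} (hk : k < 2 ^ n) :
    bellmanPoint p q hT f g n k ∈ bellmanDomain p q 𝒜 := by
  obtain ⟨hq, -⟩ := conj_exponent hp hp2 hpq
  have hf2 := Lp.integrable_two f
  have hg2 : Integrable (fun x => g x ^ 2) unitMeasure := (Lp.memLp g).integrable_sq
  refine ⟨mul_nonneg (by positivity) (sub_nonneg.2 (hT.descendantSum_le g n k)),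
    mul_nonneg (by positivity) (integral_nonneg fun x => by positivity),
    mul_nonneg (by positivity) (integral_nonneg fun x => by positivity), ?_, ?_⟩
  · refine le_trans ?_ (rpow_mul_setIntegral_le hp.le hk (fun x => norm_nonneg (f x)) hf2.norm
      (integrable_rpow_norm hp hp2 f))
    refine Real.rpow_le_rpow (norm_nonneg _) ?_ (by linarith)
    rw [bellmanPoint, norm_smul, Real.norm_of_nonneg (by positivity)]
    exact mul_le_mul_of_nonneg_left (norm_integral_le_integral_norm _) (by positivity)
  · have e : ∀ x, (g x ^ 2) ^ (q / 2) = |g x| ^ q := fun x => by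
      rw [← sq_abs, ← Real.rpow_natCast, ← Real.rpow_mul (abs_nonneg _)]
      congr 1; push_cast; ring
    have h1 := rpow_mul_setIntegral_le (r := q / 2) (by linarith) hk (fun x => sq_nonneg (g x)) hg2
      (by simpa only [e] using hg)
    simp only [e] at h1
    have h0 : 0 ≤ 2 ^ n * ∫ x in dyadicInterval n k, g x ^ 2 ∂unitMeasure :=
      mul_nonneg (by positivity) (integral_nonneg fun x => by positivity)
    have hW : 0 ≤ hT.descendantSum g n k := by
      classical
      exact tsum_nonneg fun i => by split_ifs <;> positivity
    calc 2 ^ n * (∫ x in dyadicInterval n k, g x ^ 2 ∂unitMeasure - hT.descendantSum g n k)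
        ≤ 2 ^ n * ∫ x in dyadicInterval n k, g x ^ 2 ∂unitMeasure :=
          mul_le_mul_of_nonneg_left (by linarith) (by positivity)
      _ = ((2 ^ n * ∫ x in dyadicInterval n k, g x ^ 2 ∂unitMeasure) ^ (q / 2)) ^ (2 / q) := by
          rw [← Real.rpow_mul h0, div_mul_div_comm, mul_comm q 2, div_self (by positivity),
            Real.rpow_one]
      _ ≤ _ := Real.rpow_le_rpow (by positivity) h1 (by positivity)

/-- Concavity is applied with `Δ = ‖β_I‖ |I|^(-1/2)`, because the second coordinate has defect
`‖β_I‖² / |I|`. The first coordinates of the halves differ by `2 |I|^(-1/2) f_I`, so multiplication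
by `|I|` leaves exactly `‖f_I‖ ‖β_I‖`. -/
theorem bellmanPoint_step {p q : ℝ} (hp : 1 < p) (hp2 : p ≤ 2) (hpq : 1 / p + 1 / q = 1)
    {B : EllTwo 𝒜 × ℝ × ℝ × ℝ → ℝ} (hB : IsClassK p q B)
    (hT : IsClassG T) (f : Lp (EllTwo 𝒜) 2 unitMeasure) (g : Lp ℝ 2 unitMeasure)
    (hg : Integrable (fun x => |g x| ^ q) unitMeasure) (n : ℕ) (k : Fin (2 ^ n)) :
    ‖haarCoeff f (some ⟨n, k⟩)‖ * ‖hT.pairingVec g (some ⟨n, k⟩)‖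
      + (B (bellmanPoint p q hT f g (n + 1) (2 * k)) / 2 ^ (n + 1)
        + B (bellmanPoint p q hT f g (n + 1) (2 * k + 1)) / 2 ^ (n + 1))
      ≤ B (bellmanPoint p q hT f g n k) / 2 ^ n := by
  have hf2 := Lp.integrable_two f
  have hg2 : Integrable (fun x => g x ^ 2) unitMeasure := (Lp.memLp g).integrable_sq
  have hk := k.2
  have hr0 : (0 : ℝ) ≤ 2 ^ n := by positivity
  have hrr : √((2 : ℝ) ^ n) * √(2 ^ n) = 2 ^ n := Real.mul_self_sqrt hr0
  have key := hB.concave _ (bellmanPoint_mem hp hp2 hpq hT f g hg hk)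
    (bellmanPoint p q hT f g (n + 1) (2 * k))
    (bellmanPoint_mem hp hp2 hpq hT f g hg (by rw [pow_succ]; omega))
    (bellmanPoint p q hT f g (n + 1) (2 * k + 1))
    (bellmanPoint_mem hp hp2 hpq hT f g hg (by rw [pow_succ]; omega))
    (√(2 ^ n) * ‖hT.pairingVec g (some ⟨n, k⟩)‖) ?_
  · have e1 : (bellmanPoint p q hT f g (n + 1) (2 * k)).1
        - (bellmanPoint p q hT f g (n + 1) (2 * k + 1)).1
        = (2 * √(2 ^ n)) • haarCoeff f (some ⟨n, k⟩) := by
      rw [haarCoeff, integral_haarFun_smul hf2, smul_smul, mul_assoc, hrr, ← pow_succ',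
        smul_sub]
      rfl
    rw [e1, norm_smul, abs_of_nonneg (by positivity), Real.norm_of_nonneg (by positivity)] at key
    rw [le_div_iff₀ (by positivity)]
    refine le_trans (le_of_eq ?_) key
    rw [pow_succ]
    have h2 : (2 : ℝ) ^ n ≠ 0 := by positivity
    field_simp
    linear_combination (-2 * ‖haarCoeff f (some ⟨n, k⟩)‖
      * ‖hT.pairingVec g (some ⟨n, k⟩)‖) * hrr
  · have hp' := integrable_rpow_norm hp hp2 f
    have hW := hT.descendantSum_eq g n k
    simp only [bellmanPoint, Prod.mk_add_mk, Prod.smul_mk, Prod.mk_sub_mk, Prod.mk.injEq,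
      smul_eq_mul]
    refine ⟨?_, ?_, ?_, ?_⟩
    · rw [setIntegral_dyadicInterval_eq_add hf2 n k, ← smul_add, smul_smul, pow_succ,
        sub_eq_zero]
      congr 1; ring
    · rw [setIntegral_dyadicInterval_eq_add hg2 n k, hW, mul_pow, sq (√_), hrr]
      ring
    · rw [setIntegral_dyadicInterval_eq_add hp' n k]; ring
    · rw [setIntegral_dyadicInterval_eq_add hg n k]; ring

/-- Where `f` is constant, Jensen for `‖f‖^p` is an equality, so the point lies on the boundary
`‖x₁‖^p = x₃`. -/
theorem bellmanPoint_boundary {p q : ℝ} (hp : 1 < p) (hp2 : p ≤ 2) (hpq : 1 / p + 1 / q = 1)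
    {B : EllTwo 𝒜 × ℝ × ℝ × ℝ → ℝ} (hB : IsClassK p q B)
    (hT : IsClassG T) (f : Lp (EllTwo 𝒜) 2 unitMeasure) (g : Lp ℝ 2 unitMeasure)
    (hg : Integrable (fun x => |g x| ^ q) unitMeasure) {n k : ℕ} (hk : k < 2 ^ n) {w : EllTwo 𝒜}
    (hw : ∀ᵐ x ∂unitMeasure, x ∈ dyadicInterval n k → f x = w) :
    0 ≤ B (bellmanPoint p q hT f g n k) := by
  refine hB.boundary _ (bellmanPoint_mem hp hp2 hpq hT f g hg hk) ?_
  have hm := measurableSet_dyadicInterval n k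
  have h2 : (2 : ℝ) ^ n ≠ 0 := by positivity
  have e1 : ∫ x in dyadicInterval n k, f x ∂unitMeasure = (1 / 2 ^ n : ℝ) • w := by
    rw [setIntegral_congr_ae hm hw, setIntegral_const, unitMeasure_real_dyadicInterval hk]
  have e2 : ∫ x in dyadicInterval n k, ‖f x‖ ^ p ∂unitMeasure = (1 / 2 ^ n : ℝ) * ‖w‖ ^ p := by
    rw [setIntegral_congr_ae hm (g := fun _ => ‖w‖ ^ p) (by
      filter_upwards [hw] with x hx hx'
      rw [hx hx']), setIntegral_const, unitMeasure_real_dyadicInterval hk, smul_eq_mul]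
  simp only [bellmanPoint, e1, e2, smul_smul, ← mul_assoc, mul_one_div, div_self h2, one_smul,
    one_mul]

theorem sum_norm_mul_norm_le {p q : ℝ} (hp : 1 < p) (hp2 : p ≤ 2) (hpq : 1 / p + 1 / q = 1)
    {B : EllTwo 𝒜 × ℝ × ℝ × ℝ → ℝ} (hB : IsClassK p q B)
    (hT : IsClassG T) (f : Lp (EllTwo 𝒜) 2 unitMeasure) (g : Lp ℝ 2 unitMeasure)
    (hg : Integrable (fun x => |g x| ^ q) unitMeasure) (N : ℕ)
    (hN : ∀ k : ℕ, ∃ w : EllTwo 𝒜, ∀ᵐ x ∂unitMeasure, x ∈ dyadicInterval N k → f x = w) :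
    ∑ n ∈ Finset.range N, ∑ k : Fin (2 ^ n), ‖haarCoeff f (some ⟨n, k⟩)‖
      * ‖hT.pairingVec g (some ⟨n, k⟩)‖ ≤ B (bellmanPoint p q hT f g 0 0) := by
  set S : ℕ → ℝ := fun n => ∑ k ∈ Finset.range (2 ^ n), B (bellmanPoint p q hT f g n k) / 2 ^ n
    with hS
  have step : ∀ n, ∑ k : Fin (2 ^ n), ‖haarCoeff f (some ⟨n, k⟩)‖
      * ‖hT.pairingVec g (some ⟨n, k⟩)‖ + S (n + 1) ≤ S n := by
    intro n
    simp only [hS]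
    rw [pow_succ' 2 n, sum_range_two_mul, Finset.sum_range, Finset.sum_range,
      ← Finset.sum_add_distrib]
    refine Finset.sum_le_sum fun k _ => ?_
    exact bellmanPoint_step hp hp2 hpq hB hT f g hg n k
  have tele : ∀ M, ∑ n ∈ Finset.range M, ∑ k : Fin (2 ^ n), ‖haarCoeff f (some ⟨n, k⟩)‖
      * ‖hT.pairingVec g (some ⟨n, k⟩)‖ + S M ≤ S 0 := by
    intro M
    induction M with
    | zero => simp
    | succ M ih =>
      rw [Finset.sum_range_succ]
      linarith [step M]
  have hSN : 0 ≤ S N := Finset.sum_nonneg fun k hk => by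
    obtain ⟨w, hw⟩ := hN k
    exact div_nonneg (bellmanPoint_boundary hp hp2 hpq hB hT f g hg (Finset.mem_range.1 hk) hw)
      (by positivity)
  have h0 : S 0 = B (bellmanPoint p q hT f g 0 0) := by simp [hS]
  linarith [tele N]

end Bellman

/-! ### From the bilinear estimate to the `L^p` bound -/

/-- All subtracted terms are nonnegative. For large `t` the coefficient of `y₁^p` on the second
branch is negative, but there `y₁^p < y₂^(q/2)`, and the `t`-parts combine to `(2t/q)(y₂^(q/2) -
y₁^p)`. -/
theorem bellmanCandidate_le {p q t δ C : ℝ} (hp : 1 < p) (hp2 : p ≤ 2) (hpq : 1 / p + 1 / q = 1)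
    (ht : 0 ≤ t) (hδ : 0 < δ) (hC : 0 < C) {𝒜 : Type*} {x : EllTwo 𝒜 × ℝ × ℝ × ℝ}
    (hx : x ∈ bellmanDomain p q 𝒜) :
    bellmanCandidate p q t δ C x ≤ 2 * C * (x.2.2.1 + x.2.2.2) := by
  obtain ⟨hq, -⟩ := conj_exponent hp hp2 hpq
  obtain ⟨h1, h2, h3, -, -⟩ := hx
  have a1 : 0 ≤ ‖x.1‖ ^ p := by positivity
  have a2 : 0 ≤ x.2.1 ^ (q / 2) := by positivity
  unfold bellmanCandidate bellmanZero
  rw [show 2 * C * (x.2.2.1 + x.2.2.2) = C * (2 * (x.2.2.1 + x.2.2.2)) by ring]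
  refine mul_le_mul_of_nonneg_left ?_ hC.le
  rw [sub_sub, sub_sub]
  refine sub_le_self _ (add_nonneg a1 (add_nonneg a2 (mul_nonneg hδ.le ?_)))
  split_ifs with h
  · positivity
  · have e : 2 / p * (2 - p - t * (p - 1)) = 2 * (2 / p - 1) - 2 * t * (1 / q) := by
      have hp0 : p ≠ 0 := by linarith
      have : 1 / q = 1 - 1 / p := by linarith
      rw [this]; field_simp
    have h4 : 1 ≤ 2 / p := by rw [le_div_iff₀ (by linarith)]; linarith
    have h5 : 0 ≤ 1 / q := by positivity
    rw [e, show 2 / q * (2 + t) = 4 * (1 / q) + 2 * t * (1 / q) by ring]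
    have h6 : 0 ≤ t * (1 / q) := by positivity
    nlinarith [mul_le_mul_of_nonneg_left (not_le.1 h).le h6, mul_nonneg h5 a2,
      mul_nonneg (sub_nonneg.2 h4) a1]

theorem integral_le_rpow_integral_rpow {r : ℝ} (hr : 1 ≤ r) {φ : ℝ → ℝ}
    (h0 : ∀ x, 0 ≤ φ x) (h1 : Integrable φ unitMeasure)
    (h2 : Integrable (fun x => φ x ^ r) unitMeasure) :
    ∫ x, φ x ∂unitMeasure ≤ (∫ x, φ x ^ r ∂unitMeasure) ^ (1 / r) := by
  have := rpow_mul_setIntegral_le hr (n := 0) (k := 0) (by norm_num) h0 h1 h2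
  rw [restrict_dyadicInterval_zero, pow_zero, one_mul, one_mul] at this
  have hi : 0 ≤ ∫ x, φ x ∂unitMeasure := integral_nonneg h0
  calc ∫ x, φ x ∂unitMeasure = ((∫ x, φ x ∂unitMeasure) ^ r) ^ (1 / r) := by
        rw [← Real.rpow_mul hi, mul_one_div, div_self (by linarith), Real.rpow_one]
    _ ≤ _ := Real.rpow_le_rpow (by positivity) this (by positivity)

/-- Optimal scaling in the sum of a `p`-th and a `q`-th power with given product of the bases. -/
theorem exists_mul_eq_and_rpow_add_rpow_eq {p q M : ℝ} (hp : 1 < p) (hq : 1 < q)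
    (hpq : 1 / p + 1 / q = 1) (hM : 0 < M) :
    ∃ a b : ℝ, 0 < a ∧ 0 < b ∧ a * b = M ∧ a ^ p + b ^ q = p ^ (1 / p) * q ^ (1 / q) * M := by
  have hp0 : 0 < p := by linarith
  have hq0 : 0 < q := by linarith
  set L := p ^ (1 / p) * q ^ (1 / q) with hL
  have hL0 : 0 < L := by positivity
  have hLM : 0 < L * M := by positivity
  -- The minimizer of `a^p + b^q` for fixed `a b` satisfies `p a^p = q b^q`; here both sides equal
  -- `L M`.
  refine ⟨(L * M / p) ^ (1 / p), (L * M / q) ^ (1 / q), by positivity, by positivity, ?_, ?_⟩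
  · rw [Real.div_rpow hLM.le hp0.le, Real.div_rpow hLM.le hq0.le, div_mul_div_comm,
      ← Real.rpow_add hLM, hpq, Real.rpow_one, ← hL]
    field_simp
  · rw [← Real.rpow_mul (by positivity), ← Real.rpow_mul (by positivity), one_div_mul_cancel hp0.ne',
      one_div_mul_cancel hq0.ne', Real.rpow_one, Real.rpow_one]
    calc L * M / p + L * M / q = L * M * (1 / p + 1 / q) := by ring
      _ = L * M := by rw [hpq, mul_one]

section Duality

variable {𝒜 : Type*} {T : haarSpan 𝒜 →ₗ[ℝ] (ℝ →ₘ[unitMeasure] ℝ)}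

/-- The bilinear estimate before optimal scaling. -/
theorem integral_mul_map_le_add {p q t δ C : ℝ} (hp : 1 < p) (hp2 : p ≤ 2)
    (hpq : 1 / p + 1 / q = 1) (hA : IsAdmissible p q t δ C 𝒜) (hT : IsClassG T)
    (f : haarSpan 𝒜) (g : Lp ℝ 2 unitMeasure)
    (hg : Integrable (fun x => |g x| ^ q) unitMeasure) :
    ∫ x, g x * T f x ∂unitMeasure ≤
      (∫ x, ‖(f : Lp (EllTwo 𝒜) 2 unitMeasure) x‖ ^ p ∂unitMeasure) ^ (1 / p)
          * (∫ x, |g x| ^ q ∂unitMeasure) ^ (1 / q)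
        + 2 * C * (∫ x, ‖(f : Lp (EllTwo 𝒜) 2 unitMeasure) x‖ ^ p ∂unitMeasure
          + ∫ x, |g x| ^ q ∂unitMeasure) := by
  obtain ⟨hq, -⟩ := conj_exponent hp hp2 hpq
  obtain ⟨N, hN, hconst⟩ := integral_mul_map_eq_sum hT f
  set F : Lp (EllTwo 𝒜) 2 unitMeasure := f.1 with hF
  have hFi := integrable_rpow_norm hp hp2 F
  have hF2 := Lp.integrable_two F
  rw [hN g, haarLabels, Finset.sum_insertNone, Finset.sum_sigma]
  -- The `h₀` term is estimated directly and gives the `+ 1` of the final constant; all other terms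
  -- go through the Bellman function.
  refine add_le_add ?_ ?_
  · refine (real_inner_le_norm _ _).trans (mul_le_mul ?_ ?_ (norm_nonneg _) (by positivity))
    · refine le_trans ?_ (integral_le_rpow_integral_rpow hp.le (fun x => norm_nonneg (F x))
        hF2.norm hFi)
      simpa [haarCoeff, haarFun] using norm_integral_le_integral_norm F
    · have h1 : ‖hT.pairingVec g none‖ ^ 2 ≤ ‖g‖ ^ 2 :=
        le_hasSum (hT.hasSum_norm_pairingVec g) none fun _ _ => sq_nonneg _
      have h2 : ‖g‖ ^ 2 = ∫ x, g x ^ 2 ∂unitMeasure := by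
        have := norm_sq_eq_integral (Lp.memLp g)
        rwa [Lp.toLp_coeFn] at this
      have e : ∀ x, (g x ^ 2) ^ (q / 2) = |g x| ^ q := fun x => by
        rw [← sq_abs, ← Real.rpow_natCast, ← Real.rpow_mul (abs_nonneg _)]
        congr 1; push_cast; ring
      have h3 := integral_le_rpow_integral_rpow (r := q / 2) (by linarith)
        (fun x => sq_nonneg (g x)) (Lp.memLp g).integrable_sq (by simpa only [e] using hg)
      simp only [e] at h3
      have hI : 0 ≤ ∫ x, |g x| ^ q ∂unitMeasure := integral_nonneg fun x => by positivity
      refine le_of_sq_le_sq ?_ (by positivity)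
      rw [← Real.rpow_natCast (_ ^ (1 / q)), ← Real.rpow_mul hI,
        show 1 / q * ((2 : ℕ) : ℝ) = 1 / (q / 2) by push_cast; field_simp]
      exact h1.trans (h2.le.trans h3)
  · have h1 := sum_norm_mul_norm_le hp hp2 hpq hA.mem_classK hT F g hg N hconst
    have h2 := bellmanCandidate_le hp hp2 hpq hA.t_nonneg hA.δ_pos hA.C_pos
      (bellmanPoint_mem hp hp2 hpq hT F g hg (n := 0) (k := 0) (by norm_num))
    simp only [bellmanPoint, restrict_dyadicInterval_zero, pow_zero, one_mul] at h2
    refine le_trans (Finset.sum_le_sum fun n _ => Finset.sum_le_sum fun k _ =>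
      real_inner_le_norm _ _) (h1.trans ?_)
    simpa only [bellmanPoint, restrict_dyadicInterval_zero, pow_zero, one_mul] using h2

/-- The bilinear estimate. -/
theorem integral_mul_map_le_mul {p q t δ C : ℝ} (hp : 1 < p) (hp2 : p ≤ 2)
    (hpq : 1 / p + 1 / q = 1) (hA : IsAdmissible p q t δ C 𝒜) (hT : IsClassG T)
    (f : haarSpan 𝒜) (g : Lp ℝ 2 unitMeasure)
    (hg : Integrable (fun x => |g x| ^ q) unitMeasure) :
    ∫ x, g x * T f x ∂unitMeasure ≤ (2 * p ^ (1 / p) * q ^ (1 / q) * C + 1) *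
      ((∫ x, ‖(f : Lp (EllTwo 𝒜) 2 unitMeasure) x‖ ^ p ∂unitMeasure) ^ (1 / p)
          * (∫ x, |g x| ^ q ∂unitMeasure) ^ (1 / q)) := by
  obtain ⟨hq, -⟩ := conj_exponent hp hp2 hpq
  have hC := hA.C_pos
  have hp0 : 0 < p := by linarith
  have hq0 : 0 < q := by linarith
  set F : Lp (EllTwo 𝒜) 2 unitMeasure := f.1 with hF
  have hFi := integrable_rpow_norm hp hp2 F
  set I := ∫ x, ‖F x‖ ^ p ∂unitMeasure with hI
  set J := ∫ x, |g x| ^ q ∂unitMeasure with hJ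
  have hI0 : 0 ≤ I := integral_nonneg fun x => by positivity
  have hJ0 : 0 ≤ J := integral_nonneg fun x => by positivity
  have rhs0 : 0 ≤ (2 * p ^ (1 / p) * q ^ (1 / q) * C + 1) * (I ^ (1 / p) * J ^ (1 / q)) := by
    positivity
  rcases hI0.eq_or_lt with h | hIpos
  · have h1 : f = 0 := by
      have h2 := (integral_eq_zero_iff_of_nonneg (fun x => by positivity) hFi).1 h.symm
      refine Subtype.ext (Lp.ext ?_)
      filter_upwards [h2, Lp.coeFn_zero (EllTwo 𝒜) 2 unitMeasure] with x hx hx0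
      have hx' : F x = 0 := norm_eq_zero.1 ((Real.rpow_eq_zero (norm_nonneg _) hp0.ne').1 hx)
      rw [Submodule.coe_zero, hx0]
      exact hx'
    refine le_trans (le_of_eq ?_) rhs0
    rw [h1, map_zero]
    refine integral_eq_zero_of_ae ?_
    filter_upwards [AEEqFun.coeFn_zero (μ := unitMeasure) (α := ℝ) (β := ℝ)] with x hx
    rw [hx]; simp
  rcases hJ0.eq_or_lt with h | hJpos
  · have h2 := (integral_eq_zero_iff_of_nonneg (fun x => by positivity) hg).1 h.symm
    refine le_trans (le_of_eq (integral_eq_zero_of_ae ?_)) rhs0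
    filter_upwards [h2] with x hx
    have hx' : g x = 0 := abs_eq_zero.1 ((Real.rpow_eq_zero (abs_nonneg _) hq0.ne').1 hx)
    simp [hx']
  set A := I ^ (1 / p) with hAdef
  set G := J ^ (1 / q) with hGdef
  have hA0 : 0 < A := Real.rpow_pos_of_pos hIpos _
  have hG0 : 0 < G := Real.rpow_pos_of_pos hJpos _
  have hAI : A ^ p = I := by
    rw [hAdef, ← Real.rpow_mul hI0, one_div_mul_cancel hp0.ne', Real.rpow_one]
  have hGJ : G ^ q = J := by
    rw [hGdef, ← Real.rpow_mul hJ0, one_div_mul_cancel hq0.ne', Real.rpow_one]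
  -- The factors `a / A` and `b / G` are reciprocal, so rescaling `f` and `g` by them keeps the
  -- pairing and the product of the norms while making the sum of powers optimal.
  obtain ⟨a, b, ha, hb, hab, hsum⟩ :=
    exists_mul_eq_and_rpow_add_rpow_eq hp (by linarith) hpq (mul_pos hA0 hG0)
  have hl : 0 < a / A := by positivity
  have hm : 0 < b / G := by positivity
  have hlm : a / A * (b / G) = 1 := by
    rw [div_mul_div_comm, hab, div_self (by positivity)]
  have cF := Lp.coeFn_smul (a / A) F
  have cg := Lp.coeFn_smul (b / G) g
  have eF : ∫ x, ‖((a / A) • F : Lp (EllTwo 𝒜) 2 unitMeasure) x‖ ^ p ∂unitMeasure = a ^ p := by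
    have h : ∀ᵐ x ∂unitMeasure, ‖((a / A) • F : Lp (EllTwo 𝒜) 2 unitMeasure) x‖ ^ p
        = (a / A) ^ p * ‖F x‖ ^ p := by
      filter_upwards [cF] with x hx
      rw [hx, Pi.smul_apply, norm_smul, Real.norm_of_nonneg hl.le,
        Real.mul_rpow hl.le (norm_nonneg _)]
    rw [integral_congr_ae h, integral_const_mul, ← hI, ← hAI, ← Real.mul_rpow hl.le hA0.le,
      div_mul_cancel₀ _ hA0.ne']
  have hg' : ∀ᵐ x ∂unitMeasure, |((b / G) • g : Lp ℝ 2 unitMeasure) x| ^ q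
      = (b / G) ^ q * |g x| ^ q := by
    filter_upwards [cg] with x hx
    rw [hx, Pi.smul_apply, smul_eq_mul, abs_mul, abs_of_pos hm,
      Real.mul_rpow hm.le (abs_nonneg _)]
  have eg : ∫ x, |((b / G) • g : Lp ℝ 2 unitMeasure) x| ^ q ∂unitMeasure = b ^ q := by
    rw [integral_congr_ae hg', integral_const_mul, ← hJ, ← hGJ, ← Real.mul_rpow hm.le hG0.le,
      div_mul_cancel₀ _ hG0.ne']
  have eT : ∫ x, ((b / G) • g : Lp ℝ 2 unitMeasure) x * T ((a / A) • f) x ∂unitMeasure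
      = ∫ x, g x * T f x ∂unitMeasure := by
    refine integral_congr_ae ?_
    rw [map_smul]
    filter_upwards [cg, AEEqFun.coeFn_smul (a / A) (T f)] with x h1 h2
    rw [h1, h2, Pi.smul_apply, Pi.smul_apply, smul_eq_mul, smul_eq_mul]
    linear_combination (g x * T f x) * hlm
  have key := integral_mul_map_le_add hp hp2 hpq hA hT ((a / A) • f) ((b / G) • g)
    ((hg.const_mul _).congr (hg'.mono fun x hx => hx.symm))
  rw [Submodule.coe_smul, ← hF, eF, eg, eT, hsum, ← Real.rpow_mul ha.le, ← Real.rpow_mul hb.le,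
    mul_one_div_cancel hp0.ne', mul_one_div_cancel hq0.ne', Real.rpow_one, Real.rpow_one,
    hab] at key
  linarith

theorem eLpNorm_eq_ofReal_integral {E : Type*} [NormedAddCommGroup E] {p : ℝ} (hp : 1 < p)
    (hp2 : p ≤ 2) (f : Lp E 2 unitMeasure) : eLpNorm f (ENNReal.ofReal p) unitMeasure
      = ENNReal.ofReal ((∫ x, ‖f x‖ ^ p ∂unitMeasure) ^ (1 / p)) := by
  have h : MemLp f (ENNReal.ofReal p) unitMeasure := by
    refine (Lp.memLp f).mono_exponent ?_
    rw [← ENNReal.ofReal_ofNat]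
    exact ENNReal.ofReal_le_ofReal hp2
  rw [h.eLpNorm_eq_integral_rpow_norm (by simp; linarith) ENNReal.ofReal_ne_top,
    ENNReal.toReal_ofReal (by linarith), one_div]

theorem eLpNorm_le_on_haarSpan {p q t δ C : ℝ} (hp : 1 < p) (hp2 : p ≤ 2)
    (hpq : 1 / p + 1 / q = 1) (hA : IsAdmissible p q t δ C 𝒜) (hT : IsClassG T)
    {S : Lp (EllTwo 𝒜) 2 unitMeasure →L[ℝ] Lp ℝ 2 unitMeasure} (hS : IsBoundedExtension T S)
    (f : haarSpan 𝒜) :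
    eLpNorm (S f) (ENNReal.ofReal p) unitMeasure ≤
      ENNReal.ofReal (2 * p ^ (1 / p) * q ^ (1 / q) * C + 1) *
        eLpNorm (f : Lp (EllTwo 𝒜) 2 unitMeasure) (ENNReal.ofReal p) unitMeasure := by
  obtain ⟨hq, -⟩ := conj_exponent hp hp2 hpq
  have hC := hA.C_pos
  have hp0 : 0 < p := by linarith
  have hq0 : 0 < q := by linarith
  have hpq1 : q * (p - 1) = p := by
    field_simp at hpq; linarith
  set F : Lp ℝ 2 unitMeasure := S f with hF
  have hFT : (F : ℝ →ₘ[unitMeasure] ℝ) = T f := hS f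
  rw [eLpNorm_eq_ofReal_integral hp hp2, eLpNorm_eq_ofReal_integral hp hp2,
    ← ENNReal.ofReal_mul (by positivity)]
  refine ENNReal.ofReal_le_ofReal ?_
  have hFi := integrable_rpow_norm hp hp2 F
  -- The extremal function of `L^p`-`L^q` duality. It lies in `L^q` because `q(p-1) = p`, hence in
  -- `L²` because `q ≥ 2`, so it is a legitimate test function.
  set γ : ℝ → ℝ := fun x => SignType.sign (F x) * |F x| ^ (p - 1) with hγ
  have habs : ∀ x, |γ x| ≤ |F x| ^ (p - 1) := fun x => by
    have h1 : |((SignType.sign (F x) : SignType) : ℝ)| ≤ 1 := by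
      rcases SignType.sign (F x) with _ | _ | _ <;> simp
    rw [hγ, abs_mul, abs_of_nonneg (a := |F x| ^ (p - 1)) (by positivity)]
    exact mul_le_of_le_one_left (by positivity) h1
  have hFm : Measurable F := (Lp.stronglyMeasurable F).measurable
  have hγm : Measurable γ := by
    have h1 : Measurable fun x => ((SignType.sign (F x) : SignType) : ℝ) := by
      have : Measurable fun y : ℝ => ((SignType.sign y : SignType) : ℝ) := by
        have e : (fun y : ℝ => ((SignType.sign y : SignType) : ℝ))
            = fun y => if 0 < y then 1 else if y < 0 then -1 else 0 := by
          funext y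
          rw [sign_apply]
          split_ifs <;> simp
        rw [e]
        exact Measurable.ite measurableSet_Ioi measurable_const
          (Measurable.ite measurableSet_Iio measurable_const measurable_const)
      exact this.comp hFm
    exact h1.mul (by fun_prop)
  have hγq : ∀ x, |γ x| ^ q ≤ ‖F x‖ ^ p := fun x => by
    calc |γ x| ^ q ≤ (|F x| ^ (p - 1)) ^ q := Real.rpow_le_rpow (abs_nonneg _) (habs x) hq0.le
      _ = ‖F x‖ ^ p := by
        rw [← Real.rpow_mul (abs_nonneg _), mul_comm, hpq1, Real.norm_eq_abs]
  have hγi : Integrable (fun x => |γ x| ^ q) unitMeasure := by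
    refine hFi.mono' (hγm.abs.pow_const q).aestronglyMeasurable (Filter.Eventually.of_forall fun x => ?_)
    rw [Real.norm_of_nonneg (by positivity)]
    exact hγq x
  have hγ2 : MemLp γ 2 unitMeasure := by
    have h1 : MemLp γ (ENNReal.ofReal q) unitMeasure := by
      rw [← integrable_norm_rpow_iff hγm.aestronglyMeasurable (by simp; linarith)
        ENNReal.ofReal_ne_top, ENNReal.toReal_ofReal hq0.le]
      exact hγi
    refine h1.mono_exponent ?_
    rw [← ENNReal.ofReal_ofNat]
    exact ENNReal.ofReal_le_ofReal hq
  set g : Lp ℝ 2 unitMeasure := hγ2.toLp with hg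
  have hcg := hγ2.coeFn_toLp
  have hcq : (fun x => |γ x| ^ q) =ᵐ[unitMeasure] fun x => |g x| ^ q := by
    filter_upwards [hcg] with x hx
    rw [hg, hx]
  have key := integral_mul_map_le_mul hp hp2 hpq hA hT f g (hγi.congr hcq)
  set I := ∫ x, ‖F x‖ ^ p ∂unitMeasure with hI
  have hI0 : 0 ≤ I := integral_nonneg fun x => by positivity
  have e1 : ∫ x, g x * T f x ∂unitMeasure = I := by
    refine integral_congr_ae ?_
    filter_upwards [hcg] with x hx
    rw [← hFT, hg, hx, hγ, Real.norm_eq_abs]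
    show SignType.sign (F x) * |F x| ^ (p - 1) * F x = |F x| ^ p
    rw [mul_right_comm, sign_mul_self, ← Real.rpow_one_add' (abs_nonneg _) (by linarith)]
    ring_nf
  have e2 : ∫ x, |g x| ^ q ∂unitMeasure ≤ I := by
    rw [← integral_congr_ae hcq]
    exact integral_mono hγi hFi hγq
  set K := 2 * p ^ (1 / p) * q ^ (1 / q) * C + 1 with hK
  have hK0 : 0 ≤ K := by positivity
  set A := (∫ x, ‖(f : Lp (EllTwo 𝒜) 2 unitMeasure) x‖ ^ p ∂unitMeasure) ^ (1 / p) with hAdef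
  have hA0 : 0 ≤ A := Real.rpow_nonneg (integral_nonneg fun x => by positivity) _
  rw [e1] at key
  have key' : I ≤ K * A * I ^ (1 / q) := by
    refine key.trans ?_
    rw [mul_assoc]
    have : (∫ x, |g x| ^ q ∂unitMeasure) ^ (1 / q) ≤ I ^ (1 / q) :=
      Real.rpow_le_rpow (integral_nonneg fun x => by positivity) e2 (by positivity)
    gcongr
  rcases hI0.eq_or_lt with h | hIpos
  · rw [← h, Real.zero_rpow (by positivity)]
    positivity
  · have hIq : 0 < I ^ (1 / q) := Real.rpow_pos_of_pos hIpos _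
    -- Cancelling `I^(1/q)` is allowed since `I` is finite a priori, `F` being in `L²`.
    refine le_of_mul_le_mul_right (le_trans (le_of_eq ?_) key') hIq
    rw [← Real.rpow_add hIpos, hpq, Real.rpow_one]

theorem eLpNorm_le_add_enorm_sub {E : Type*} [NormedAddCommGroup E] {p : ℝ} (hp : 1 < p)
    (hp2 : p ≤ 2) (u v : Lp E 2 unitMeasure) :
    eLpNorm v (ENNReal.ofReal p) unitMeasure
      ≤ eLpNorm u (ENNReal.ofReal p) unitMeasure + ‖v - u‖ₑ := by
  have hp1 : 1 ≤ ENNReal.ofReal p := by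
    rw [← ENNReal.ofReal_one]; exact ENNReal.ofReal_le_ofReal hp.le
  have hp2' : ENNReal.ofReal p ≤ 2 := by
    rw [← ENNReal.ofReal_ofNat]; exact ENNReal.ofReal_le_ofReal hp2
  have h : (v : ℝ → E) =ᵐ[unitMeasure] (u : ℝ → E) + ((v - u : Lp E 2 unitMeasure) : ℝ → E) := by
    filter_upwards [Lp.coeFn_sub v u] with x hx
    rw [Pi.add_apply, hx, Pi.sub_apply, add_sub_cancel]
  rw [eLpNorm_congr_ae h, Lp.enorm_def]
  exact (eLpNorm_add_le (Lp.aestronglyMeasurable u) (Lp.aestronglyMeasurable _) hp1).trans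
    (add_le_add le_rfl (eLpNorm_le_eLpNorm_of_exponent_le hp2' (Lp.aestronglyMeasurable _)))

-- On a probability space the `L²` norm dominates the `L^p` norm, so `L²` approximation from the
-- Haar span controls both `f` and its image in `L^p`.
open Filter Topology in
theorem eLpNorm_le_of_isBoundedExtension {p q t δ C : ℝ} (hp : 1 < p) (hp2 : p ≤ 2)
    (hpq : 1 / p + 1 / q = 1) (hA : IsAdmissible p q t δ C 𝒜) (hT : IsClassG T)
    {S : Lp (EllTwo 𝒜) 2 unitMeasure →L[ℝ] Lp ℝ 2 unitMeasure} (hS : IsBoundedExtension T S)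
    (f : Lp (EllTwo 𝒜) 2 unitMeasure) :
    eLpNorm (S f) (ENNReal.ofReal p) unitMeasure ≤
      ENNReal.ofReal (2 * p ^ (1 / p) * q ^ (1 / q) * C + 1) *
        eLpNorm f (ENNReal.ofReal p) unitMeasure := by
  set K := ENNReal.ofReal (2 * p ^ (1 / p) * q ^ (1 / q) * C + 1) with hK
  have hmem : f ∈ closure (haarSpan 𝒜 : Set (Lp (EllTwo 𝒜) 2 unitMeasure)) := by
    have := topologicalClosure_haarSpan 𝒜
    rw [← Submodule.topologicalClosure_coe, this]
    trivial
  obtain ⟨u, hu, hlim⟩ := mem_closure_iff_seq_limit.1 hmem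
  have h1 : ∀ n, eLpNorm (S f) (ENNReal.ofReal p) unitMeasure
      ≤ K * (eLpNorm f (ENNReal.ofReal p) unitMeasure + ‖u n - f‖ₑ) + ‖S f - S (u n)‖ₑ :=
    fun n => (eLpNorm_le_add_enorm_sub hp hp2 (S (u n)) (S f)).trans <| add_le_add
      ((eLpNorm_le_on_haarSpan hp hp2 hpq hA hT hS ⟨u n, hu n⟩).trans
        (mul_le_mul_right (eLpNorm_le_add_enorm_sub hp hp2 f (u n)) K)) le_rfl
  have l1 : Tendsto (fun n => ‖u n - f‖ₑ) atTop (𝓝 0) := by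
    have : Tendsto (fun n => ‖u n - f‖ₑ) atTop (𝓝 ‖f - f‖ₑ) :=
      (hlim.sub tendsto_const_nhds).enorm
    simpa using this
  have l2 : Tendsto (fun n => ‖S f - S (u n)‖ₑ) atTop (𝓝 0) := by
    have : Tendsto (fun n => ‖S f - S (u n)‖ₑ) atTop (𝓝 ‖S f - S f‖ₑ) :=
      (tendsto_const_nhds.sub ((S.continuous.tendsto f).comp hlim)).enorm
    simpa using this
  have l3 : Tendsto (fun n => K * (eLpNorm f (ENNReal.ofReal p) unitMeasure + ‖u n - f‖ₑ)
      + ‖S f - S (u n)‖ₑ) atTop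
      (𝓝 (K * (eLpNorm f (ENNReal.ofReal p) unitMeasure + 0) + 0)) :=
    (ENNReal.Tendsto.const_mul (tendsto_const_nhds.add l1) (Or.inr ENNReal.ofReal_ne_top)).add l2
  rw [add_zero, add_zero] at l3
  exact ge_of_tendsto' l3 h1

end Duality

theorem mainTheorem1 (p q : ℝ) (hp : 1 < p) (hp2 : p ≤ 2) (hpq : 1 / p + 1 / q = 1) :
    (∃ t δ C : ℝ, ∀ (𝒜 : Type u) [Countable 𝒜], IsAdmissible p q t δ C 𝒜) ∧
    ∀ (𝒜 : Type u) [Countable 𝒜] (T : haarSpan 𝒜 →ₗ[ℝ] (ℝ →ₘ[unitMeasure] ℝ)),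
      IsClassG T →
        (∃! S : Lp (EllTwo 𝒜) 2 unitMeasure →L[ℝ] Lp ℝ 2 unitMeasure,
          IsBoundedExtension T S) ∧
        ∀ S : Lp (EllTwo 𝒜) 2 unitMeasure →L[ℝ] Lp ℝ 2 unitMeasure,
          IsBoundedExtension T S →
            ∀ t δ C : ℝ, IsAdmissible p q t δ C 𝒜 →
              ∀ f : Lp (EllTwo 𝒜) 2 unitMeasure,
                eLpNorm (S f) (ENNReal.ofReal p) unitMeasure ≤
                  ENNReal.ofReal (2 * p ^ (1 / p) * q ^ (1 / q) * C + 1) *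
                    eLpNorm f (ENNReal.ofReal p) unitMeasure :=
  ⟨⟨1, _, _, fun 𝒜 _ => isAdmissible_explicit hp hp2 hpq 𝒜⟩,
    fun _ _ _ hT => ⟨hT.existsUnique_extension,
      fun _ hS _ _ _ hA f => eLpNorm_le_of_isBoundedExtension hp hp2 hpq hA hT hS f⟩⟩
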